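/- Let $n\ge 1$, let $\Omega\subset\mathbb R^n$ be a bounded Lipschitz domain (a nonempty bounded open set whose boundary is locally the graph of a Lipschitz function, with $\Omega$ on one side of it; connectedness is not required), $\Omega_e=\mathbb R^n\setminus\overline\Omega$, $T>0$, $0<s<1$, $m>1$, $0<\lambda\le\Lambda<\infty$, and $\Phi^m(r)=|r|^{m-1}r$. The space $H^s(\mathbb R^n)$ carries the norm $\|f\|_{H^s(\mathbb R^n)}^2=\|f\|_{L^2(\mathbb R^n)}^2+\iint_{\mathbb R^{2n}}\frac{|f(x)-f(y)|^2}{|x-y|^{n+2s}}\,dx\,dy$, $\widetilde H^s(\Omega)$ is the closure of $C_c^\infty(\Omega)$ in $H^s(\mathbb R^n)$, and $H^{-s}(\Omega)$ is the dual of $\widetilde H^s(\Omega)$; a function $f\in L^2(\Omega)$ is identified with the functional $\psi\mapsto\int_\Omega f\psi\,dx$. Let $K:\mathbb R^n\times\mathbb R^n\to\mathbb R$ be measurable with $K(x,y)=K(y,x)$ and $\lambda\le K\le\Lambda$, let $L_K$ be the associated integro-differential operator of order $2s$, and let $$B_K(f,g)=\iint_{\mathbb R^{2n}}K(x,y)\frac{(f(x)-f(y))(g(x)-g(y))}{|x-y|^{n+2s}}\,dx\,dy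 .$$ For $u_0\in L^\infty(\Omega)\cap\widetilde H^s(\Omega)$ and $\varphi\in C_c([0,T]\times\Omega_e)$ (extended by zero) with $\Phi^m(\varphi)\in L^2(0,T;H^s(\mathbb R^n))$, a (weak) solution of $$\partial_t u+L_K(\Phi^m(u))=0\ \text{in }\Omega\times(0,T),\qquad u=\varphi\ \text{in }\Omega_e\times(0,T),\qquad u(0)=u_0\ \text{in }\Omega \tag{1}$$ is a function $u:\mathbb R^n\times(0,T)\to\mathbb R$ with $\Phi^m(u)\in L^2(0,T;H^s(\mathbb R^n))$, $\Phi^m(u-\varphi)\in L^2(0,T;\widetilde H^s(\Omega))$ and $$-\int_{\Omega\times(0,T)}u\,\partial_t\psi\,dx\,dt+\int_0^TB_K(\Phi^m(u),\psi)\,dt=\int_\Omega u_0\,\psi(0)\,dx\qquad\text{for all }\psi\in C_c^\infty([0,T)\times\Omega).$$ **Theorem.** There is a constant $C>0$, depending only on $n,\Omega,T,s,m,\lambda,\Lambda$, such that the following holds. If, for $j=1,2$, $u_{0,j}\in L^\infty(\Omega)\cap\widetilde H^s(\Omega)$, $\varphi_j\in C_c([0,T]\times\Omega_e)$ with $\Phi^m(\varphi_j)\in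 L^2(0,T;H^s(\mathbb R^n))$, and $u_j$ is a solution of (1) with data $(u_{0,j},\varphi_j)$ (with the same $K$), then $$\|u_1-u_2\|_{L^\infty(0,T;H^{-s}(\Omega))}+\|\mathcal U_1-\mathcal U_2\|_{L^\infty(0,T;H^s(\mathbb R^n))}\le C\Big(\|u_{0,1}-u_{0,2}\|_{H^{-s}(\Omega)}+\|\Phi^m(\varphi_1)-\Phi^m(\varphi_2)\|_{L^1(0,T;H^s(\mathbb R^n))}\Big),$$ where $\mathcal U_j(x,t)=\int_0^t\Phi^m(u_j(x,\tau))\,d\tau$. In particular, solutions of (1) are unique: two solutions with the same data $(u_0,\varphi)$ agree almost everywhere in $\mathbb R^n\times(0,T)$. -/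

import Mathlib

open Set MeasureTheory
open scoped ENNReal

noncomputable section

/-- A bounded Lipschitz domain of `ℝⁿ`: a nonempty bounded open set which near each of its boundary
points is, in the direction of some unit vector `e`, the strict subgraph of a Lipschitz function
of the components orthogonal to `e`. Connectedness is not required. -/
structure IsBoundedLipschitzDomain {n : ℕ} (Ω : Set (EuclideanSpace ℝ (Fin n))) : Prop where
  isOpen : IsOpen Ω
  nonempty : Ω.Nonempty
  isBounded : Bornology.IsBounded Ω
  lipschitz_boundary : ∀ x₀ ∈ frontier Ω,
    ∃ (e : EuclideanSpace ℝ (Fin n)) (g : EuclideanSpace ℝ (Fin n) → ℝ) (L : NNReal)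
      (V : Set (EuclideanSpace ℝ (Fin n))),
      ‖e‖ = 1 ∧ LipschitzWith L g ∧ IsOpen V ∧ x₀ ∈ V ∧
        ∀ x ∈ V, x ∈ Ω ↔ inner ℝ x e < g (x - (inner ℝ x e : ℝ) • e)

/-- The exterior `Ω_e = ℝⁿ \ closure Ω`. -/
def exteriorOf {n : ℕ} (Ω : Set (EuclideanSpace ℝ (Fin n))) : Set (EuclideanSpace ℝ (Fin n)) :=
  (closure Ω)ᶜ

/-- The nonlinearity `Φ^m(r) = |r|^(m-1) r`. -/
def porousPhi (m r : ℝ) : ℝ := |r| ^ (m - 1) * r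

/-- The squared Gagliardo seminorm `[f]²` of order `s` on `ℝⁿ`. -/
def gagliardoSq {n : ℕ} (s : ℝ) (f : EuclideanSpace ℝ (Fin n) → ℝ) : ℝ≥0∞ :=
  ∫⁻ p : EuclideanSpace ℝ (Fin n) × EuclideanSpace ℝ (Fin n),
    ENNReal.ofReal ((f p.1 - f p.2) ^ 2 / ‖p.1 - p.2‖ ^ ((n : ℝ) + 2 * s))

/-- The norm of `H^s(ℝⁿ) = W^{s,2}(ℝⁿ)`, with values in `[0, ∞]`. -/
def hsNorm {n : ℕ} (s : ℝ) (f : EuclideanSpace ℝ (Fin n) → ℝ) : ℝ≥0∞ :=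
  ((∫⁻ x, ENNReal.ofReal (f x ^ 2)) + gagliardoSq s f) ^ (1 / 2 : ℝ)

/-- `f ∈ H^s(ℝⁿ)`. -/
def MemHs {n : ℕ} (s : ℝ) (f : EuclideanSpace ℝ (Fin n) → ℝ) : Prop :=
  MemLp f 2 volume ∧ gagliardoSq s f < ∞

/-- `f` belongs to the closure of `C_c^∞(Ω)` in `H^s(ℝⁿ)`. -/
def MemHsTilde {n : ℕ} (Ω : Set (EuclideanSpace ℝ (Fin n))) (s : ℝ)
    (f : EuclideanSpace ℝ (Fin n) → ℝ) : Prop :=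
  MemHs s f ∧ ∀ ε : ℝ, 0 < ε → ∃ ψ : EuclideanSpace ℝ (Fin n) → ℝ,
    ContDiff ℝ (⊤ : ℕ∞) ψ ∧ HasCompactSupport ψ ∧ tsupport ψ ⊆ Ω ∧
      hsNorm s (fun x => f x - ψ x) < ENNReal.ofReal ε

open Classical in
/-- The norm in `H^{-s}(Ω)`, the dual of the closure of `C_c^∞(Ω)` in `H^s(ℝⁿ)`, of the functional
`ψ ↦ ∫_Ω f ψ`; it is `∞` if this integral does not converge absolutely for some `ψ`. -/
def hNegNorm {n : ℕ} (Ω : Set (EuclideanSpace ℝ (Fin n))) (s : ℝ)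
    (f : EuclideanSpace ℝ (Fin n) → ℝ) : ℝ≥0∞ :=
  ⨆ (ψ : EuclideanSpace ℝ (Fin n) → ℝ) (_ : MemHsTilde Ω s ψ) (_ : hsNorm s ψ ≤ 1),
    if IntegrableOn (fun x => f x * ψ x) Ω then ENNReal.ofReal |∫ x in Ω, f x * ψ x| else ∞

/-- `w ∈ L²(0,T;H^s(ℝⁿ))` for a space-time function `w` (time is the first argument).
Since `H^s(ℝⁿ)` is separable, joint measurability of `w` gives the measurability of
`t ↦ w t` as a map into `H^s(ℝⁿ)`. -/
def MemL2Hs {n : ℕ} (T s : ℝ) (w : ℝ → EuclideanSpace ℝ (Fin n) → ℝ) : Prop :=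
  AEStronglyMeasurable (Function.uncurry w) ((volume.restrict (Ioo 0 T)).prod volume) ∧
  (∀ᵐ t ∂volume.restrict (Ioo 0 T), MemHs s (w t)) ∧
  ∫⁻ t in Ioo 0 T, hsNorm s (w t) ^ 2 < ∞

/-- `w ∈ L²(0,T;X)`, where `X` is the closure of `C_c^∞(Ω)` in `H^s(ℝⁿ)`. -/
def MemL2HsTilde {n : ℕ} (Ω : Set (EuclideanSpace ℝ (Fin n))) (T s : ℝ)
    (w : ℝ → EuclideanSpace ℝ (Fin n) → ℝ) : Prop :=
  MemL2Hs T s w ∧ ∀ᵐ t ∂volume.restrict (Ioo 0 T), MemHsTilde Ω s (w t)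

/-- The norm of `L¹(0,T;H^s(ℝⁿ))`. -/
def l1HsNorm {n : ℕ} (T s : ℝ) (w : ℝ → EuclideanSpace ℝ (Fin n) → ℝ) : ℝ≥0∞ :=
  ∫⁻ t in Ioo 0 T, hsNorm s (w t)

/-- The norm of `L^∞(0,T;H^s(ℝⁿ))`. -/
def lInftyHsNorm {n : ℕ} (T s : ℝ) (w : ℝ → EuclideanSpace ℝ (Fin n) → ℝ) : ℝ≥0∞ :=
  essSup (fun t => hsNorm s (w t)) (volume.restrict (Ioo 0 T))

/-- The norm of `L^∞(0,T;H^{-s}(Ω))`. -/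
def lInftyHNegNorm {n : ℕ} (Ω : Set (EuclideanSpace ℝ (Fin n))) (T s : ℝ)
    (w : ℝ → EuclideanSpace ℝ (Fin n) → ℝ) : ℝ≥0∞ :=
  essSup (fun t => hNegNorm Ω s (w t)) (volume.restrict (Ioo 0 T))

/-- The kernels of the operators `L_K` in the class `𝓛₀`, with ellipticity constants `lam`
and `Lam`. -/
structure IsEllipticKernel {n : ℕ} (lam Lam : ℝ)
    (K : EuclideanSpace ℝ (Fin n) → EuclideanSpace ℝ (Fin n) → ℝ) : Prop where
  measurable : Measurable (Function.uncurry K)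
  symm : ∀ x y, K x y = K y x
  lower : ∀ x y, lam ≤ K x y
  upper : ∀ x y, K x y ≤ Lam

/-- The bilinear form `B_K` of `L_K`. -/
def bilinForm {n : ℕ} (s : ℝ) (K : EuclideanSpace ℝ (Fin n) → EuclideanSpace ℝ (Fin n) → ℝ)
    (f g : EuclideanSpace ℝ (Fin n) → ℝ) : ℝ :=
  ∫ p : EuclideanSpace ℝ (Fin n) × EuclideanSpace ℝ (Fin n),
    K p.1 p.2 * ((f p.1 - f p.2) * (g p.1 - g p.2)) / ‖p.1 - p.2‖ ^ ((n : ℝ) + 2 * s)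

/-- Test functions in `C_c^∞([0,T) × Ω)`, given as restrictions of functions in
`C_c^∞((-∞,T) × Ω)`. -/
structure IsTestFunction {n : ℕ} (Ω : Set (EuclideanSpace ℝ (Fin n))) (T : ℝ)
    (ψ : ℝ → EuclideanSpace ℝ (Fin n) → ℝ) : Prop where
  contDiff : ContDiff ℝ (⊤ : ℕ∞) (Function.uncurry ψ)
  hasCompactSupport : HasCompactSupport (Function.uncurry ψ)
  tsupport_subset : tsupport (Function.uncurry ψ) ⊆ Iio T ×ˢ Ω

/-- Exterior conditions: `φ ∈ C_c([0,T] × Ω_e)`, extended by zero to `[0,T] × ℝⁿ`, with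
`Φ^m(φ) ∈ L²(0,T;H^s(ℝⁿ))`. -/
structure IsExteriorDatum {n : ℕ} (Ω : Set (EuclideanSpace ℝ (Fin n))) (T s m : ℝ)
    (φ : ℝ → EuclideanSpace ℝ (Fin n) → ℝ) : Prop where
  continuousOn : ContinuousOn (Function.uncurry φ) (Icc 0 T ×ˢ exteriorOf Ω)
  compact_support : ∃ S : Set (ℝ × EuclideanSpace ℝ (Fin n)), IsCompact S ∧
    S ⊆ Icc 0 T ×ˢ exteriorOf Ω ∧ ∀ t ∈ Icc 0 T, ∀ x, (t, x) ∉ S → φ t x = 0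
  memL2Hs : MemL2Hs T s (fun t x => porousPhi m (φ t x))

/-- Initial data in `L^∞(Ω)` that also belong to the closure of `C_c^∞(Ω)` in `H^s(ℝⁿ)`. -/
structure IsInitialDatum {n : ℕ} (Ω : Set (EuclideanSpace ℝ (Fin n))) (s : ℝ)
    (u₀ : EuclideanSpace ℝ (Fin n) → ℝ) : Prop where
  memLp_top : MemLp u₀ ∞ (volume.restrict Ω)
  memHsTilde : MemHsTilde Ω s u₀

/-- Weak solutions `u : ℝⁿ × (0,T) → ℝ` of `∂_t u + L_K(Φ^m(u)) = 0` in `Ω × (0,T)`, `u = φ` in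
`Ω_e × (0,T)`, `u(0) = u₀` in `Ω`. -/
structure IsWeakSolution {n : ℕ} (Ω : Set (EuclideanSpace ℝ (Fin n))) (T s m : ℝ)
    (K : EuclideanSpace ℝ (Fin n) → EuclideanSpace ℝ (Fin n) → ℝ)
    (u₀ : EuclideanSpace ℝ (Fin n) → ℝ) (φ : ℝ → EuclideanSpace ℝ (Fin n) → ℝ)
    (u : ℝ → EuclideanSpace ℝ (Fin n) → ℝ) : Prop where
  memL2Hs : MemL2Hs T s (fun t x => porousPhi m (u t x))
  exterior : MemL2HsTilde Ω T s (fun t x => porousPhi m (u t x - φ t x))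
  weak_form : ∀ ψ : ℝ → EuclideanSpace ℝ (Fin n) → ℝ, IsTestFunction Ω T ψ →
    -(∫ p in Ioo 0 T ×ˢ Ω, u p.1 p.2 * deriv (fun τ => ψ τ p.2) p.1) +
      (∫ t in Ioo 0 T, bilinForm s K (fun x => porousPhi m (u t x)) (ψ t)) =
    ∫ x in Ω, u₀ x * ψ 0 x

/-- The time primitive `∫₀ᵗ Φ^m(u(x,τ)) dτ`. -/
def timePrimitive {n : ℕ} (m : ℝ) (u : ℝ → EuclideanSpace ℝ (Fin n) → ℝ) (t : ℝ)
    (x : EuclideanSpace ℝ (Fin n)) : ℝ :=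
  ∫ τ in Ioo 0 t, porousPhi m (u τ x)

end

/-! ### Square-integrable functions on product spaces. -/

section SquareIntegrable

variable {P : Type*} [MeasurableSpace P] {μ : Measure P}

/-! The proof is Oleinik's duality argument. Write w = u₁ - u₂, w₀ = u₀₁ - u₀₂, V = Φ^m(u₁) -
Φ^m(u₂), g = Φ^m(φ₁) - Φ^m(φ₂) and U(t) = ∫₀ᵗ V. Integrating the difference of the two equations in
time removes the time derivative: for almost every t and every f in the closure of the test
functions, ∫_Ω w(t) f + B_K(U(t), f) = ∫_Ω w₀ f (`IsWeakSolution.ae_forall_integral_eq`,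
`ae_forall_integral_sub_eq`).

The choice f = V(t) - g(t) is admissible. The exterior data vanish in Ω, so the first term is ∫_Ω w
V, which is nonnegative because Φ^m is increasing. Since V = ∂_t U, dropping this term and
integrating over (0,r) yields `energy_inequality`: ½ B_K(U(r), U(r)) ≤ ∫₀ʳ B_K(U, g) dt + ∫_Ω w₀
(U(r) - ∫₀ʳ g). The first term on the right is at most a multiple of the supremum of the energy norm
of U times the L¹(0,T;H^s) norm of g. The second is at most the dual norm of w₀ times an H^s norm
that the Poincaré inequality `exists_poincare_const` reduces to a seminorm. Absorbing the supremum
(`le_mul_of_forall_sq_le`) bounds U linearly by the data, and the integrated identity then bounds w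
in the dual norm (`exists_stability_const`).

For equal data w(t) has dual norm zero; pairing it with V(t) and using strict monotonicity forces u₁
= u₂ (`IsWeakSolution.ae_eq`).

Throughout, H^s is seen through pairs (f, difference quotient of f) in L², so that time-dependent
functions are elements of L² on a product and Fubini replaces vector-valued integration. -/

theorem eLpNorm_two_sq (f : P → ℝ) :
    eLpNorm f 2 μ ^ 2 = ∫⁻ x, ENNReal.ofReal (f x ^ 2) ∂μ := by
  have h := eLpNorm_nnreal_pow_eq_lintegral (f := f) (μ := μ) (p := 2) (by norm_num)
  have e : ∀ x : ℝ≥0∞, x ^ ((2 : NNReal) : ℝ) = x ^ 2 := fun x => by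
    rw [← ENNReal.rpow_natCast]; norm_num
  simp only [e] at h
  rw [show ((2 : NNReal) : ℝ≥0∞) = 2 by norm_num] at h
  rw [h]
  refine lintegral_congr fun x => ?_
  rw [← sq_abs, ENNReal.ofReal_pow (abs_nonneg _), ← Real.enorm_eq_ofReal_abs]

theorem abs_integral_mul_le {f g : P → ℝ} (hf : MemLp f 2 μ) (hg : MemLp g 2 μ) :
    |∫ x, f x * g x ∂μ| ≤ (eLpNorm f 2 μ).toReal * (eLpNorm g 2 μ).toReal := by
  have h := abs_real_inner_le_norm (hg.toLp g) (hf.toLp f)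
  rw [Lp.norm_toLp, Lp.norm_toLp, L2.inner_def, mul_comm (ENNReal.toReal _)] at h
  convert h using 2
  refine integral_congr_ae ?_
  filter_upwards [hf.coeFn_toLp, hg.coeFn_toLp] with x h1 h2
  simp [h1, h2]

theorem integral_mul_self_eq {f : P → ℝ} (hf : MemLp f 2 μ) :
    ∫ x, f x * f x ∂μ = (eLpNorm f 2 μ).toReal ^ 2 := by
  have h := real_inner_self_eq_norm_sq (hf.toLp f)
  rw [Lp.norm_toLp, L2.inner_def] at h
  rw [← h]
  refine integral_congr_ae ?_
  filter_upwards [hf.coeFn_toLp] with x h1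
  simp [h1, pow_two]

theorem integrable_mul_of_memLp_two {f g : P → ℝ} (hf : MemLp f 2 μ) (hg : MemLp g 2 μ) :
    Integrable (fun x => f x * g x) μ :=
  hf.integrable_mul hg

variable {R : Type*} [MeasurableSpace R] {ρ : Measure R} [SFinite μ]

/-- Tonelli. This identifies L² in time with values in L² with L² of the product measure, the
setting of all later time integrations. -/
theorem lintegral_eLpNorm_two_sq {f : R → P → ℝ}
    (hf : AEStronglyMeasurable (Function.uncurry f) (ρ.prod μ)) :
    ∫⁻ t, eLpNorm (f t) 2 μ ^ 2 ∂ρ = eLpNorm (Function.uncurry f) 2 (ρ.prod μ) ^ 2 := by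
  rw [eLpNorm_two_sq, lintegral_prod]
  · exact lintegral_congr fun t => eLpNorm_two_sq _
  · exact (hf.aemeasurable.pow_const 2).ennreal_ofReal

theorem aemeasurable_eLpNorm_two {f : R → P → ℝ}
    (hf : AEStronglyMeasurable (Function.uncurry f) (ρ.prod μ)) :
    AEMeasurable (fun t => eLpNorm (f t) 2 μ) ρ := by
  have h : AEMeasurable (fun t => eLpNorm (f t) 2 μ ^ 2) ρ := by
    simp_rw [eLpNorm_two_sq]
    exact (hf.aemeasurable.pow_const 2).ennreal_ofReal.lintegral_prod_right'
  have h2 := h.pow_const (1 / 2 : ℝ)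
  refine h2.congr (.of_forall fun t => ?_)
  simp only
  rw [← ENNReal.rpow_natCast, ← ENNReal.rpow_mul]
  norm_num

theorem memLp_two_uncurry_iff {f : R → P → ℝ}
    (hf : AEStronglyMeasurable (Function.uncurry f) (ρ.prod μ)) :
    MemLp (Function.uncurry f) 2 (ρ.prod μ) ↔ ∫⁻ t, eLpNorm (f t) 2 μ ^ 2 ∂ρ < ∞ := by
  rw [lintegral_eLpNorm_two_sq hf]
  constructor
  · intro h
    exact ENNReal.pow_lt_top h.2
  · intro h
    refine ⟨hf, ?_⟩
    by_contra h'
    simp only [not_lt, top_le_iff] at h'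
    simp [h'] at h

theorem ae_memLp_of_uncurry {f : R → P → ℝ} (hf : MemLp (Function.uncurry f) 2 (ρ.prod μ)) :
    ∀ᵐ t ∂ρ, MemLp (f t) 2 μ := by
  have h := (memLp_two_uncurry_iff hf.1).1 hf
  have h2 := ae_lt_top' ((aemeasurable_eLpNorm_two hf.1).pow_const 2) h.ne
  filter_upwards [h2, hf.1.prodMk_left] with t h3 h4
  refine ⟨h4, ?_⟩
  by_contra h'
  simp only [not_lt, top_le_iff] at h'
  simp [h'] at h3

theorem ae_memLp_of_uncurry_swap [SFinite ρ] {f : R → P → ℝ}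
    (hf : MemLp (Function.uncurry f) 2 (ρ.prod μ)) :
    ∀ᵐ p ∂μ, MemLp (fun t => f t p) 2 ρ := by
  have h : MemLp (Function.uncurry fun p t => f t p) 2 (μ.prod ρ) :=
    hf.comp_measurePreserving Measure.measurePreserving_swap
  exact ae_memLp_of_uncurry h

theorem memLp_uncurry_const [IsFiniteMeasure ρ] {q : P → ℝ} (hq : MemLp q 2 μ) :
    MemLp (Function.uncurry fun _ : R => q) 2 (ρ.prod μ) := by
  rw [memLp_two_uncurry_iff (hq.1.comp_snd)]
  simp only [lintegral_const]
  exact ENNReal.mul_lt_top (ENNReal.pow_lt_top hq.2) (measure_lt_top _ _)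

theorem integrable_integral_mul [SFinite ρ] {f g : R → P → ℝ}
    (hf : MemLp (Function.uncurry f) 2 (ρ.prod μ))
    (hg : MemLp (Function.uncurry g) 2 (ρ.prod μ)) :
    Integrable (fun t => ∫ p, f t p * g t p ∂μ) ρ :=
  (integrable_mul_of_memLp_two hf hg).integral_prod_left

end SquareIntegrable

/-! ### Primitives in time. -/

/-- The primitive `∫₀ᵗ h(τ,p) dτ` of a time dependent function. -/
noncomputable def timeIntegral {P : Type*} (h : ℝ → P → ℝ) (t : ℝ) (p : P) : ℝ :=
  ∫ τ in Ioo 0 t, h τ p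

section TimeIntegral

variable {P : Type*} [MeasurableSpace P] {μ : Measure P} [SigmaFinite μ] {T : ℝ} {h : ℝ → P → ℝ}

theorem memLp_restrict_Ioo {t : ℝ} (ht : t ≤ T)
    (hh : MemLp (Function.uncurry h) 2 ((volume.restrict (Ioo 0 T)).prod μ)) :
    MemLp (Function.uncurry h) 2 ((volume.restrict (Ioo 0 t)).prod μ) :=
  hh.mono_measure (Measure.prod_mono (Measure.restrict_mono (Ioo_subset_Ioo_right ht) le_rfl)
    le_rfl)

/-- Cauchy–Schwarz in time for each p. The bound is only used qualitatively: it puts the primitive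
in L² and makes a supremum over t finite. -/
theorem eLpNorm_timeIntegral_sq_le {t : ℝ} (ht : t ≤ T)
    (hh : MemLp (Function.uncurry h) 2 ((volume.restrict (Ioo 0 T)).prod μ)) :
    eLpNorm (timeIntegral h t) 2 μ ^ 2 ≤ ENNReal.ofReal T *
      eLpNorm (Function.uncurry h) 2 ((volume.restrict (Ioo 0 T)).prod μ) ^ 2 := by
  have hs : MemLp (Function.uncurry fun p t => h t p) 2
      (μ.prod (volume.restrict (Ioo 0 T))) :=
    hh.comp_measurePreserving Measure.measurePreserving_swap
  have e : eLpNorm (Function.uncurry h) 2 ((volume.restrict (Ioo 0 T)).prod μ) =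
      eLpNorm (Function.uncurry fun p t => h t p) 2 (μ.prod (volume.restrict (Ioo 0 T))) :=
    (eLpNorm_comp_measurePreserving hh.1 Measure.measurePreserving_swap).symm
  rw [e, ← lintegral_eLpNorm_two_sq hs.1, ← lintegral_const_mul'' _
    ((aemeasurable_eLpNorm_two hs.1).pow_const 2), eLpNorm_two_sq]
  refine lintegral_mono_ae ?_
  filter_upwards [ae_memLp_of_uncurry hs] with p hp
  have h1 : ‖timeIntegral h t p‖ₑ ≤ ∫⁻ τ in Ioo 0 T, ‖h τ p‖ₑ :=
    (enorm_integral_le_lintegral_enorm _).trans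
      (lintegral_mono' (Measure.restrict_mono (Ioo_subset_Ioo_right ht) le_rfl) le_rfl)
  have h2 := eLpNorm_le_eLpNorm_mul_rpow_measure_univ (p := 1) (q := 2) (by norm_num) hp.1
  rw [eLpNorm_one_eq_lintegral_enorm] at h2
  have h3 := pow_le_pow_left' (h1.trans h2) 2
  rw [← sq_abs, ENNReal.ofReal_pow (abs_nonneg _), ← Real.enorm_eq_ofReal_abs]
  refine h3.trans (le_of_eq ?_)
  rw [mul_pow, mul_comm]
  congr 1
  simp only [Measure.restrict_apply_univ, Real.volume_Ioo, sub_zero]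
  rw [← ENNReal.rpow_natCast, ← ENNReal.rpow_mul]
  norm_num

theorem ae_integrableOn_Ioo
    (hh : MemLp (Function.uncurry h) 2 ((volume.restrict (Ioo 0 T)).prod μ)) :
    ∀ᵐ p ∂μ, IntegrableOn (fun t => h t p) (Ioo 0 T) := by
  filter_upwards [ae_memLp_of_uncurry_swap hh] with p hp
  exact hp.integrable (by norm_num)

theorem aestronglyMeasurable_timeIntegral {t : ℝ} (ht : t ≤ T)
    (hh : MemLp (Function.uncurry h) 2 ((volume.restrict (Ioo 0 T)).prod μ)) :
    AEStronglyMeasurable (timeIntegral h t) μ := by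
  have hs : MemLp (Function.uncurry fun p t => h t p) 2
      (μ.prod (volume.restrict (Ioo 0 t))) :=
    (memLp_restrict_Ioo ht hh).comp_measurePreserving Measure.measurePreserving_swap
  exact hs.1.integral_prod_right'

theorem memLp_timeIntegral {t : ℝ} (ht : t ≤ T)
    (hh : MemLp (Function.uncurry h) 2 ((volume.restrict (Ioo 0 T)).prod μ)) :
    MemLp (timeIntegral h t) 2 μ := by
  refine ⟨aestronglyMeasurable_timeIntegral ht hh, ?_⟩
  have h1 := (eLpNorm_timeIntegral_sq_le ht hh).trans_lt
    (ENNReal.mul_lt_top ENNReal.ofReal_lt_top (ENNReal.pow_lt_top hh.2))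
  by_contra h'
  simp only [not_lt, top_le_iff] at h'
  simp [h'] at h1

theorem aestronglyMeasurable_uncurry_timeIntegral
    (hh : MemLp (Function.uncurry h) 2 ((volume.restrict (Ioo 0 T)).prod μ)) :
    AEStronglyMeasurable (Function.uncurry (timeIntegral h))
      ((volume.restrict (Ioo 0 T)).prod μ) := by
  set I : Measure ℝ := volume.restrict (Ioo 0 T)
  have hq : Measure.QuasiMeasurePreserving (fun z : (ℝ × P) × ℝ => (z.2, z.1.2))
      ((I.prod μ).prod I) (I.prod μ) := by
    have h1 : Measure.QuasiMeasurePreserving (Prod.map id Prod.snd : ℝ × (ℝ × P) → ℝ × P)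
        (I.prod (I.prod μ)) (I.prod μ) :=
      MeasureTheory.QuasiMeasurePreserving.prodMap (Measure.QuasiMeasurePreserving.id I)
        Measure.quasiMeasurePreserving_snd
    exact h1.comp (Measure.measurePreserving_swap (μ := I.prod μ)
      (ν := I)).quasiMeasurePreserving
  -- The variable endpoint is moved into the indicator of τ < t, so that the primitive becomes an
  -- integral over the fixed interval (0,T) of a jointly measurable function of ((t,p),τ).
  have h1 : AEStronglyMeasurable ({z : (ℝ × P) × ℝ | z.2 < z.1.1}.indicator
      (fun z => h z.2 z.1.2)) ((I.prod μ).prod I) :=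
    AEStronglyMeasurable.indicator (hh.1.comp_quasiMeasurePreserving hq)
      (measurableSet_lt measurable_snd (measurable_fst.comp measurable_fst))
  refine h1.integral_prod_right'.congr ?_
  have h2 : ∀ᵐ z ∂(I.prod μ), z.1 ∈ Ioo 0 T :=
    Measure.quasiMeasurePreserving_fst.ae (ae_restrict_mem measurableSet_Ioo)
  filter_upwards [h2] with z hz
  have h3 : (fun τ => {z : (ℝ × P) × ℝ | z.2 < z.1.1}.indicator (fun z => h z.2 z.1.2) (z, τ)) =
      (Iio z.1).indicator fun τ => h τ z.2 := by
    ext τ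
    simp [indicator]
  rw [h3, integral_indicator measurableSet_Iio, Measure.restrict_restrict measurableSet_Iio]
  have h4 : Iio z.1 ∩ Ioo 0 T = Ioo 0 z.1 := by
    ext τ
    simp only [mem_inter_iff, mem_Iio, mem_Ioo]
    exact ⟨fun h => ⟨h.2.1, h.1⟩, fun h => ⟨h.2, h.1, h.2.trans hz.2⟩⟩
  rw [h4]
  rfl

theorem memLp_uncurry_timeIntegral
    (hh : MemLp (Function.uncurry h) 2 ((volume.restrict (Ioo 0 T)).prod μ)) :
    MemLp (Function.uncurry (timeIntegral h)) 2 ((volume.restrict (Ioo 0 T)).prod μ) := by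
  rw [memLp_two_uncurry_iff (aestronglyMeasurable_uncurry_timeIntegral hh)]
  have h1 : ∫⁻ t in Ioo 0 T, eLpNorm (timeIntegral h t) 2 μ ^ 2 ≤
      ∫⁻ t in Ioo 0 T, ENNReal.ofReal T *
        eLpNorm (Function.uncurry h) 2 ((volume.restrict (Ioo 0 T)).prod μ) ^ 2 :=
    setLIntegral_mono' measurableSet_Ioo fun t ht => eLpNorm_timeIntegral_sq_le ht.2.le hh
  refine h1.trans_lt ?_
  simp only [lintegral_const]
  exact ENNReal.mul_lt_top (ENNReal.mul_lt_top ENNReal.ofReal_lt_top (ENNReal.pow_lt_top hh.2))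
    (by simp)

theorem integral_timeIntegral_mul {t : ℝ} (ht : t ≤ T)
    (hh : MemLp (Function.uncurry h) 2 ((volume.restrict (Ioo 0 T)).prod μ))
    {q : P → ℝ} (hq : MemLp q 2 μ) :
    ∫ p, timeIntegral h t p * q p ∂μ = ∫ τ in Ioo 0 t, ∫ p, h τ p * q p ∂μ := by
  have h1 := integrable_mul_of_memLp_two (memLp_restrict_Ioo ht hh)
    (memLp_uncurry_const (ρ := volume.restrict (Ioo 0 t)) hq)
  rw [integral_integral_swap (f := fun τ p => h τ p * q p) h1]
  exact integral_congr_ae (.of_forall fun p => (integral_mul_const _ _).symm)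

/-- Minkowski's integral inequality, by duality: pair the primitive with itself, exchange the
integrals, apply Cauchy–Schwarz for each τ, and cancel one factor of the norm. It is what lets the
L¹ norm in time appear in the final estimate. -/
theorem eLpNorm_timeIntegral_le {t : ℝ} (ht : t ≤ T)
    (hh : MemLp (Function.uncurry h) 2 ((volume.restrict (Ioo 0 T)).prod μ)) :
    eLpNorm (timeIntegral h t) 2 μ ≤ ∫⁻ τ in Ioo 0 T, eLpNorm (h τ) 2 μ := by
  have hH := memLp_timeIntegral ht hh
  have hm := memLp_restrict_Ioo ht hh
  have hfin : ∫⁻ τ in Ioo 0 t, eLpNorm (h τ) 2 μ ≠ ∞ := by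
    have h1 := (memLp_two_uncurry_iff hm.1).1 hm
    refine ((lintegral_mono (g := fun τ => 1 + eLpNorm (h τ) 2 μ ^ 2) fun τ => ?_).trans_lt
      ?_).ne
    · show eLpNorm (h τ) 2 μ ≤ 1 + eLpNorm (h τ) 2 μ ^ 2
      rcases le_total (eLpNorm (h τ) 2 μ) 1 with h2 | h2
      · exact h2.trans le_self_add
      · exact (le_self_pow₀ h2 two_ne_zero).trans le_add_self
    · rw [lintegral_add_left measurable_const]
      exact ENNReal.add_lt_top.2 ⟨by simp, h1⟩
  have hme := aemeasurable_eLpNorm_two hm.1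
  refine le_trans ?_ (lintegral_mono' (Measure.restrict_mono (Ioo_subset_Ioo_right ht) le_rfl)
    le_rfl)
  have hint : Integrable (fun τ => (eLpNorm (h τ) 2 μ).toReal) (volume.restrict (Ioo 0 t)) :=
    integrable_toReal_of_lintegral_ne_top hme hfin
  rcases eq_or_ne (eLpNorm (timeIntegral h t) 2 μ).toReal 0 with h0 | h0
  · rw [(ENNReal.toReal_eq_zero_iff _).1 h0 |>.resolve_right hH.2.ne]
    exact zero_le
  have h2 : (eLpNorm (timeIntegral h t) 2 μ).toReal ^ 2 ≤
      (∫ τ in Ioo 0 t, (eLpNorm (h τ) 2 μ).toReal) * (eLpNorm (timeIntegral h t) 2 μ).toReal := by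
    rw [← integral_mul_self_eq hH, integral_timeIntegral_mul ht hh hH, ← integral_mul_const]
    refine integral_mono_ae (integrable_integral_mul hm (memLp_uncurry_const hH))
      (hint.mul_const _) ?_
    filter_upwards [ae_memLp_of_uncurry hm] with τ hτ
    exact (le_abs_self _).trans (abs_integral_mul_le hτ hH)
  have h3 : (eLpNorm (timeIntegral h t) 2 μ).toReal ≤
      ∫ τ in Ioo 0 t, (eLpNorm (h τ) 2 μ).toReal := by
    have : 0 < (eLpNorm (timeIntegral h t) 2 μ).toReal :=
      lt_of_le_of_ne ENNReal.toReal_nonneg h0.symm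
    nlinarith
  rw [integral_toReal hme (ae_lt_top' hme hfin)] at h3
  exact (ENNReal.toReal_le_toReal hH.2.ne hfin).1 h3

/-- The primitive F is absolutely continuous with F' = f almost everywhere and F(0) = 0; integrating
F F' by parts gives F(r)² minus the same integral. -/
theorem integral_mul_primitive {f : ℝ → ℝ} {r : ℝ} (hr : 0 ≤ r) (hf : IntegrableOn f (Ioo 0 r)) :
    ∫ t in Ioo 0 r, (∫ τ in Ioo 0 t, f τ) * f t = 2⁻¹ * (∫ τ in Ioo 0 r, f τ) ^ 2 := by
  have hi : IntervalIntegrable f volume 0 r := by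
    rwa [intervalIntegrable_iff_integrableOn_Ioo_of_le hr]
  have hF := hi.absolutelyContinuousOnInterval_intervalIntegral (c := 0) (by simp)
  have h1 := hF.integral_mul_deriv_eq_deriv_mul hF
  have h2 : ∀ᵐ x, x ∈ uIoc 0 r → deriv (fun x => ∫ v in 0..x, f v) x = f x := by
    filter_upwards [hi.ae_hasDerivAt_integral] with x hx hx2
    exact (hx (uIoc_subset_uIcc hx2) 0 (by simp)).deriv
  have e1 : ∫ x in 0..r, (∫ v in 0..x, f v) * deriv (fun x => ∫ v in 0..x, f v) x =
      ∫ x in 0..r, (∫ v in 0..x, f v) * f x :=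
    intervalIntegral.integral_congr_ae (by filter_upwards [h2] with x hx hx2; rw [hx hx2])
  have e2 : ∫ x in 0..r, deriv (fun x => ∫ v in 0..x, f v) x * (∫ v in 0..x, f v) =
      ∫ x in 0..r, (∫ v in 0..x, f v) * f x :=
    intervalIntegral.integral_congr_ae (by
      filter_upwards [h2] with x hx hx2; rw [hx hx2, mul_comm])
  rw [e1, e2] at h1
  have h3 : ∀ g : ℝ → ℝ, ∀ t, 0 ≤ t → ∫ x in 0..t, g x = ∫ x in Ioo 0 t, g x := fun g t ht => by
    rw [intervalIntegral.integral_of_le ht, integral_Ioc_eq_integral_Ioo]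
  have e3 : ∫ t in Ioo 0 r, (∫ τ in Ioo 0 t, f τ) * f t =
      ∫ x in 0..r, (∫ v in 0..x, f v) * f x := by
    rw [h3 _ r hr]
    exact setIntegral_congr_fun measurableSet_Ioo fun t ht => by simp only [h3 f t ht.1.le]
  rw [e3, ← h3 f r hr]
  simp only [intervalIntegral.integral_same] at h1
  linarith

/-- The source of the quadratic energy: applied to weighted difference quotients, it reads ∫₀ʳ
B_K(U, ∂_t U) dt = ½ B_K(U(r), U(r)). -/
theorem integral_timeIntegral_mul_self {r : ℝ} (hr : 0 ≤ r) (hrT : r ≤ T)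
    (hh : MemLp (Function.uncurry h) 2 ((volume.restrict (Ioo 0 T)).prod μ)) :
    ∫ t in Ioo 0 r, ∫ p, timeIntegral h t p * h t p ∂μ =
      2⁻¹ * (eLpNorm (timeIntegral h r) 2 μ).toReal ^ 2 := by
  have hm := memLp_restrict_Ioo hrT hh
  rw [integral_integral_swap (f := fun t p => timeIntegral h t p * h t p)
    (integrable_mul_of_memLp_two (memLp_uncurry_timeIntegral hm) hm),
    ← integral_mul_self_eq (memLp_timeIntegral hrT hh), ← integral_const_mul]
  refine integral_congr_ae ?_
  filter_upwards [ae_integrableOn_Ioo hm] with p hp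
  rw [← pow_two]
  exact integral_mul_primitive hr hp

end TimeIntegral

/-! ### Weak derivatives in one variable. -/

/-- A smooth function with compact support in `(0,T)` agrees on `(0,T)` with the derivative of a
smooth function with compact support in `(-∞,T)`. -/
theorem exists_primitive_of_tsupport_subset {T : ℝ} (hT : 0 < T) {ζ : ℝ → ℝ}
    (hζ : ContDiff ℝ (⊤ : ℕ∞) ζ) (hc : HasCompactSupport ζ) (hs : tsupport ζ ⊆ Ioo 0 T) :
    ∃ η : ℝ → ℝ, ContDiff ℝ (⊤ : ℕ∞) η ∧ HasCompactSupport η ∧ tsupport η ⊆ Iio T ∧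
      ∀ t ∈ Ioo 0 T, deriv η t = ζ t := by
  -- Inserting T/2 keeps the compact set nonempty when ζ = 0. Its greatest element a is below T, and
  -- ζ vanishes beyond a.
  obtain ⟨a, ha, hamax⟩ := (hc.isCompact.insert (T / 2)).exists_isGreatest ⟨_, mem_insert _ _⟩
  have haT : a < T := by
    rcases ha with rfl | ha
    · linarith
    · exact (hs ha).2
  have hz : ∀ t, a < t → ζ t = 0 := fun t ht => by
    by_contra h
    exact absurd (hamax (mem_insert_of_mem _ (subset_tsupport _ h))) (not_le.2 ht)
  -- With base point T the primitive vanishes to the right of a. It may be a nonzero constant to the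
  -- left of the support of ζ, and the cutoff χ, equal to 1 on (0,T), removes that tail.
  set F : ℝ → ℝ := fun t => ∫ v in T..t, ζ v
  have hFd : ∀ t, HasDerivAt F (ζ t) t := fun t =>
    intervalIntegral.integral_hasDerivAt_right (hζ.continuous.intervalIntegrable _ _)
      hζ.continuous.aestronglyMeasurable.stronglyMeasurableAtFilter hζ.continuous.continuousAt
  have hF : ContDiff ℝ (⊤ : ℕ∞) F := by
    rw [contDiff_infty_iff_deriv]
    refine ⟨fun t => (hFd t).differentiableAt, ?_⟩
    rwa [show deriv F = ζ from funext fun t => (hFd t).deriv]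
  have hF0 : ∀ t, a < t → F t = 0 := fun t ht => by
    refine intervalIntegral.integral_zero_ae (.of_forall fun x hx => hz x ?_)
    rw [uIoc, mem_Ioc] at hx
    exact (lt_min haT ht).trans hx.1
  let χ : ContDiffBump (0 : ℝ) := ⟨T + 1, T + 2, by linarith, by linarith⟩
  refine ⟨fun t => χ t * F t, χ.contDiff.mul hF, χ.hasCompactSupport.mul_right, ?_, ?_⟩
  · refine (closure_minimal (t := Iic a) (fun t ht => ?_) isClosed_Iic).trans (Iic_subset_Iio.2 haT)
    by_contra h
    exact ht (by simp [hF0 t (not_le.1 h)])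
  · intro t ht
    have h1 : (fun t => χ t * F t) =ᶠ[nhds t] F := by
      filter_upwards [isOpen_Ioo.mem_nhds ht] with x hx
      have : x ∈ Metric.closedBall (0 : ℝ) χ.rIn := by
        rw [mem_closedBall_zero_iff, Real.norm_eq_abs, abs_of_pos hx.1]
        show x ≤ T + 1
        linarith [hx.2]
      rw [χ.one_of_mem_closedBall this, one_mul]
    rw [h1.deriv_eq]
    exact (hFd t).deriv

/-- A function whose distributional derivative on `[0,T)`, with initial value `c`, is `-b` is
almost everywhere equal to `c - ∫₀ᵗ b`. -/
theorem ae_add_integral_eq_of_weak_deriv {T : ℝ} (hT : 0 < T) {a b : ℝ → ℝ} {c : ℝ}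
    (ha : IntegrableOn a (Ioo 0 T)) (hb : IntegrableOn b (Ioo 0 T))
    (H : ∀ η : ℝ → ℝ, ContDiff ℝ (⊤ : ℕ∞) η → HasCompactSupport η → tsupport η ⊆ Iio T →
      -(∫ t in Ioo 0 T, a t * deriv η t) + ∫ t in Ioo 0 T, η t * b t = η 0 * c) :
    ∀ᵐ t ∂volume.restrict (Ioo 0 T), a t + ∫ τ in Ioo 0 t, b τ = c := by
  have hi : IntervalIntegrable b volume 0 T := by
    rwa [intervalIntegrable_iff_integrableOn_Ioo_of_le hT.le]
  have hB := hi.absolutelyContinuousOnInterval_intervalIntegral (c := 0) (by simp)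
  have hBi : IntegrableOn (fun x => ∫ v in 0..x, b v) (Ioo 0 T) := by
    have := hB.continuousOn
    rw [uIcc_of_le hT.le] at this
    exact (this.integrableOn_Icc).mono_set Ioo_subset_Icc_self
  have h3 : ∀ g : ℝ → ℝ, ∀ t, 0 ≤ t → ∫ x in 0..t, g x = ∫ x in Ioo 0 t, g x := fun g t ht => by
    rw [intervalIntegral.integral_of_le ht, integral_Ioc_eq_integral_Ioo]
  have key : IntegrableOn (fun t => a t + (∫ v in 0..t, b v) - c) (Ioo 0 T) :=
    (ha.add hBi).sub (integrableOn_const (by simp))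
  -- The fundamental lemma of the calculus of variations, applied to a + ∫₀ᵗ b - c. A test function
  -- ζ is replaced by η'; integration by parts turns its pairing with this function into the
  -- hypothesis for η, and ∫ η' = -η(0) accounts for the constant c.
  have h0 := isOpen_Ioo.ae_eq_zero_of_integral_contDiff_smul_eq_zero (U := Ioo 0 T)
    (μ := volume) key.locallyIntegrableOn (fun ζ hζ hc hs => ?_)
  · filter_upwards [ae_restrict_of_ae h0, ae_restrict_mem measurableSet_Ioo] with t ht1 ht2
    have := ht1 ht2
    rw [h3 _ _ ht2.1.le] at this
    linarith
  obtain ⟨η, hη, hηc, hηs, hd⟩ := exists_primitive_of_tsupport_subset hT hζ hc hs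
  have hηac : AbsolutelyContinuousOnInterval η 0 T :=
    (hη.contDiffOn.of_le (by exact_mod_cast le_top)).absolutelyContinuousOnInterval
  have hηT : η T = 0 := by
    by_contra h
    exact lt_irrefl T (hηs (subset_tsupport _ h))
  have e1 := hB.integral_mul_deriv_eq_deriv_mul hηac
  have h2 : ∀ᵐ x, x ∈ uIoc 0 T → deriv (fun x => ∫ v in 0..x, b v) x = b x := by
    filter_upwards [hi.ae_hasDerivAt_integral] with x hx hx2
    exact (hx (uIoc_subset_uIcc hx2) 0 (by simp)).deriv
  have e2 : ∫ x in 0..T, deriv (fun x => ∫ v in 0..x, b v) x * η x = ∫ x in 0..T, η x * b x :=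
    intervalIntegral.integral_congr_ae (by
      filter_upwards [h2] with x hx hx2; rw [hx hx2, mul_comm])
  have e3 := hηac.integral_deriv_eq_sub
  rw [e2] at e1
  simp only [hηT, intervalIntegral.integral_same, h3 _ T hT.le] at e1 e3
  have e4 := H η hη hηc hηs
  have hηd : Continuous (deriv η) := hη.continuous_deriv (by exact_mod_cast le_top)
  have hbd : ∃ M, ∀ x, ‖deriv η x‖ ≤ M := hηd.bounded_above_of_compact_support hηc.deriv
  obtain ⟨M, hM⟩ := hbd
  have i1 : IntegrableOn (fun t => a t * deriv η t) (Ioo 0 T) :=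
    ha.mul_bdd hηd.aestronglyMeasurable (.of_forall hM)
  have i2 : IntegrableOn (fun t => (∫ v in 0..t, b v) * deriv η t) (Ioo 0 T) :=
    hBi.mul_bdd hηd.aestronglyMeasurable (.of_forall hM)
  have i3 : IntegrableOn (fun t => deriv η t * c) (Ioo 0 T) :=
    ((hηd.integrableOn_Icc).mono_set Ioo_subset_Icc_self).mul_const c
  have e5 : ∫ t, ζ t • (a t + (∫ v in 0..t, b v) - c) =
      ∫ t in Ioo 0 T, (a t * deriv η t + (∫ v in 0..t, b v) * deriv η t - deriv η t * c) := by
    rw [← setIntegral_eq_integral_of_forall_compl_eq_zero (s := Ioo 0 T)]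
    · refine setIntegral_congr_fun measurableSet_Ioo fun t ht => ?_
      simp only [smul_eq_mul, hd t ht]
      ring
    · intro t ht
      rw [image_eq_zero_of_notMem_tsupport fun h => ht (hs h), zero_smul]
  have i12 : IntegrableOn (fun t => a t * deriv η t + (∫ v in 0..t, b v) * deriv η t) (Ioo 0 T) :=
    i1.add i2
  rw [e5, integral_sub i12 i3, integral_add i1 i2, e1, integral_mul_const, e3]
  linarith

/-! ### Difference quotients, the bilinear form and the Poincaré inequality. -/

section Gagliardo

variable {n : ℕ} {s : ℝ}

local notation "𝔼" k:max => EuclideanSpace ℝ (Fin k)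

/-- The difference quotient whose `L²` norm is the Gagliardo seminorm. -/
noncomputable def fracDiff (s : ℝ) (f : 𝔼 n → ℝ) (p : 𝔼 n × 𝔼 n) : ℝ :=
  (f p.1 - f p.2) / ‖p.1 - p.2‖ ^ (((n : ℝ) + 2 * s) / 2)

/-- The weighted difference quotient whose `L²` inner product is the bilinear form `B_K`. -/
noncomputable def kernelDiff (s : ℝ) (K : 𝔼 n → 𝔼 n → ℝ) (f : 𝔼 n → ℝ) (p : 𝔼 n × 𝔼 n) : ℝ :=
  √(K p.1 p.2) * fracDiff s f p

theorem fracDiff_mul (f g : 𝔼 n → ℝ) (p : 𝔼 n × 𝔼 n) : fracDiff s f p * fracDiff s g p =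
    (f p.1 - f p.2) * (g p.1 - g p.2) / ‖p.1 - p.2‖ ^ ((n : ℝ) + 2 * s) := by
  have h : ‖p.1 - p.2‖ ^ ((n : ℝ) + 2 * s) = ‖p.1 - p.2‖ ^ (((n : ℝ) + 2 * s) / 2) *
      ‖p.1 - p.2‖ ^ (((n : ℝ) + 2 * s) / 2) := by
    rw [← pow_two, ← Real.rpow_mul_natCast (norm_nonneg _)]
    norm_num
  rw [fracDiff, fracDiff, h, div_mul_div_comm]

theorem fracDiff_sub (f g : 𝔼 n → ℝ) :
    fracDiff s (fun x => f x - g x) = fun p => fracDiff s f p - fracDiff s g p := by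
  ext p
  simp only [fracDiff]
  ring

theorem fracDiff_add (f g : 𝔼 n → ℝ) :
    fracDiff s (fun x => f x + g x) = fun p => fracDiff s f p + fracDiff s g p := by
  ext p
  simp only [fracDiff]
  ring

theorem fracDiff_const_mul (c : ℝ) (f : 𝔼 n → ℝ) :
    fracDiff s (fun x => c * f x) = fun p => c * fracDiff s f p := by
  ext p
  simp only [fracDiff]
  ring

theorem kernelDiff_sub (K : 𝔼 n → 𝔼 n → ℝ) (f g : 𝔼 n → ℝ) :
    kernelDiff s K (fun x => f x - g x) = fun p => kernelDiff s K f p - kernelDiff s K g p := by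
  ext p
  simp only [kernelDiff, fracDiff_sub]
  ring

theorem kernelDiff_const_mul (K : 𝔼 n → 𝔼 n → ℝ) (c : ℝ) (f : 𝔼 n → ℝ) :
    kernelDiff s K (fun x => c * f x) = fun p => c * kernelDiff s K f p := by
  ext p
  simp only [kernelDiff, fracDiff_const_mul]
  ring

theorem gagliardoSq_eq (f : 𝔼 n → ℝ) : gagliardoSq s f = eLpNorm (fracDiff s f) 2 volume ^ 2 := by
  rw [eLpNorm_two_sq, gagliardoSq]
  refine lintegral_congr fun p => ?_
  rw [pow_two (fracDiff s f p), fracDiff_mul, pow_two]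

/-- Splitting K evenly as √K · √K turns the form into an L² inner product, so Cauchy–Schwarz and the
identity for primitives apply to it directly. -/
theorem bilinForm_eq {K : 𝔼 n → 𝔼 n → ℝ} (hK : ∀ x y, 0 ≤ K x y) (f g : 𝔼 n → ℝ) :
    bilinForm s K f g = ∫ p, kernelDiff s K f p * kernelDiff s K g p := by
  refine integral_congr_ae (.of_forall fun p => ?_)
  simp only [kernelDiff]
  rw [mul_mul_mul_comm, Real.mul_self_sqrt (hK _ _), fracDiff_mul, mul_div_assoc]

theorem hsNorm_sq (f : 𝔼 n → ℝ) :
    hsNorm s f ^ 2 = eLpNorm f 2 volume ^ 2 + eLpNorm (fracDiff s f) 2 volume ^ 2 := by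
  rw [hsNorm, gagliardoSq_eq, eLpNorm_two_sq, eLpNorm_two_sq, ← ENNReal.rpow_natCast,
    ← ENNReal.rpow_mul]
  norm_num

theorem le_of_pow_two_le {a b : ℝ≥0∞} (h : a ^ 2 ≤ b ^ 2) : a ≤ b :=
  (ENNReal.pow_le_pow_left_iff two_ne_zero).1 h

theorem eLpNorm_le_hsNorm (f : 𝔼 n → ℝ) : eLpNorm f 2 volume ≤ hsNorm s f :=
  le_of_pow_two_le (by rw [hsNorm_sq]; exact le_self_add)

theorem eLpNorm_fracDiff_le_hsNorm (f : 𝔼 n → ℝ) : eLpNorm (fracDiff s f) 2 volume ≤ hsNorm s f :=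
  le_of_pow_two_le (by rw [hsNorm_sq]; exact le_add_self)

theorem hsNorm_le (f : 𝔼 n → ℝ) :
    hsNorm s f ≤ eLpNorm f 2 volume + eLpNorm (fracDiff s f) 2 volume := by
  refine le_of_pow_two_le ?_
  rw [hsNorm_sq, add_sq]
  gcongr
  exact le_self_add

theorem measurable_fracDiff_weight :
    Measurable fun p : 𝔼 n × 𝔼 n => ‖p.1 - p.2‖ ^ (((n : ℝ) + 2 * s) / 2) :=
  (measurable_fst.sub measurable_snd).norm.pow_const _

theorem aestronglyMeasurable_fracDiff {f : 𝔼 n → ℝ} (hf : AEStronglyMeasurable f volume) :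
    AEStronglyMeasurable (fracDiff s f) volume :=
  ((hf.comp_fst.sub hf.comp_snd).aemeasurable.div
    measurable_fracDiff_weight.aemeasurable).aestronglyMeasurable

theorem fracDiff_ae_congr {f g : 𝔼 n → ℝ} (h : f =ᵐ[volume] g) :
    fracDiff s f =ᵐ[volume] fracDiff s g := by
  have h1 : ∀ᵐ p : 𝔼 n × 𝔼 n, f p.1 = g p.1 := Measure.quasiMeasurePreserving_fst.ae h
  have h2 : ∀ᵐ p : 𝔼 n × 𝔼 n, f p.2 = g p.2 := Measure.quasiMeasurePreserving_snd.ae h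
  filter_upwards [h1, h2] with p h1 h2
  rw [fracDiff, fracDiff, h1, h2]

theorem hsNorm_ae_congr {f g : 𝔼 n → ℝ} (h : f =ᵐ[volume] g) : hsNorm s f = hsNorm s g := by
  refine le_antisymm (le_of_pow_two_le ?_) (le_of_pow_two_le ?_) <;>
  rw [hsNorm_sq, hsNorm_sq, eLpNorm_congr_ae h, eLpNorm_congr_ae (fracDiff_ae_congr h)]

theorem memHs_iff {f : 𝔼 n → ℝ} :
    MemHs s f ↔ MemLp f 2 volume ∧ MemLp (fracDiff s f) 2 volume := by
  refine and_congr_right fun hf => ?_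
  rw [gagliardoSq_eq]
  constructor
  · intro h
    refine ⟨aestronglyMeasurable_fracDiff hf.1, ?_⟩
    by_contra h'
    simp only [not_lt, top_le_iff] at h'
    simp [h'] at h
  · intro h
    exact ENNReal.pow_lt_top h.2

theorem MemHs.hsNorm_lt_top {f : 𝔼 n → ℝ} (hf : MemHs s f) : hsNorm s f < ∞ :=
  (hsNorm_le f).trans_lt (ENNReal.add_lt_top.2 ⟨(memHs_iff.1 hf).1.2, (memHs_iff.1 hf).2.2⟩)

section Kernel

variable {lam Lam : ℝ} {K : 𝔼 n → 𝔼 n → ℝ}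

theorem IsEllipticKernel.nonneg (hK : IsEllipticKernel lam Lam K) (hlam : 0 < lam) (x y : 𝔼 n) :
    0 ≤ K x y :=
  hlam.le.trans (hK.lower x y)

theorem IsEllipticKernel.measurable_sqrt (hK : IsEllipticKernel lam Lam K) :
    Measurable fun p : 𝔼 n × 𝔼 n => √(K p.1 p.2) :=
  hK.measurable.sqrt

theorem IsEllipticKernel.eLpNorm_kernelDiff_le (hK : IsEllipticKernel lam Lam K) (f : 𝔼 n → ℝ) :
    eLpNorm (kernelDiff s K f) 2 volume ≤
      ENNReal.ofReal √Lam * eLpNorm (fracDiff s f) 2 volume := by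
  refine eLpNorm_le_mul_eLpNorm_of_ae_le_mul (.of_forall fun p => ?_) 2
  rw [kernelDiff, norm_mul, Real.norm_of_nonneg (Real.sqrt_nonneg _)]
  exact mul_le_mul_of_nonneg_right (Real.sqrt_le_sqrt (hK.upper _ _)) (norm_nonneg _)

theorem IsEllipticKernel.eLpNorm_fracDiff_le (hK : IsEllipticKernel lam Lam K) (hlam : 0 < lam)
    (f : 𝔼 n → ℝ) :
    eLpNorm (fracDiff s f) 2 volume ≤
      ENNReal.ofReal (√lam)⁻¹ * eLpNorm (kernelDiff s K f) 2 volume := by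
  refine eLpNorm_le_mul_eLpNorm_of_ae_le_mul (.of_forall fun p => ?_) 2
  rw [kernelDiff, norm_mul, Real.norm_of_nonneg (Real.sqrt_nonneg _), ← mul_assoc]
  refine le_mul_of_one_le_left (norm_nonneg _) ?_
  rw [inv_mul_eq_div, one_le_div (Real.sqrt_pos.2 hlam)]
  exact Real.sqrt_le_sqrt (hK.lower _ _)

theorem IsEllipticKernel.memLp_kernelDiff (hK : IsEllipticKernel lam Lam K) {f : 𝔼 n → ℝ}
    (hf : MemLp (fracDiff s f) 2 volume) : MemLp (kernelDiff s K f) 2 volume :=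
  ⟨hK.measurable_sqrt.aestronglyMeasurable.mul hf.1,
    (hK.eLpNorm_kernelDiff_le f).trans_lt (ENNReal.mul_lt_top ENNReal.ofReal_lt_top hf.2)⟩

theorem IsEllipticKernel.memLp_uncurry_kernelDiff (hK : IsEllipticKernel lam Lam K)
    {ρ : Measure ℝ} {w : ℝ → 𝔼 n → ℝ}
    (hw : MemLp (Function.uncurry fun t => fracDiff s (w t)) 2 (ρ.prod volume)) :
    MemLp (Function.uncurry fun t => kernelDiff s K (w t)) 2 (ρ.prod volume) := by
  refine MemLp.of_le_mul (c := √Lam) hw ?_ (.of_forall fun z => ?_)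
  · exact (hK.measurable_sqrt.comp measurable_snd).aestronglyMeasurable.mul hw.1
  · simp only [Function.uncurry, kernelDiff]
    rw [norm_mul, Real.norm_of_nonneg (Real.sqrt_nonneg _)]
    exact mul_le_mul_of_nonneg_right (Real.sqrt_le_sqrt (hK.upper _ _)) (norm_nonneg _)

end Kernel

theorem aestronglyMeasurable_uncurry_fracDiff {ρ : Measure ℝ} [SFinite ρ] {w : ℝ → 𝔼 n → ℝ}
    (hw : AEStronglyMeasurable (Function.uncurry w) (ρ.prod volume)) :
    AEStronglyMeasurable (Function.uncurry fun t => fracDiff s (w t)) (ρ.prod volume) := by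
  have h1 := hw.comp_quasiMeasurePreserving (MeasureTheory.QuasiMeasurePreserving.prodMap
    (Measure.QuasiMeasurePreserving.id ρ)
    (Measure.quasiMeasurePreserving_fst (μ := (volume : Measure (𝔼 n))) (ν := (volume : Measure (𝔼 n)))))
  have h2 := hw.comp_quasiMeasurePreserving (MeasureTheory.QuasiMeasurePreserving.prodMap
    (Measure.QuasiMeasurePreserving.id ρ)
    (Measure.quasiMeasurePreserving_snd (μ := (volume : Measure (𝔼 n))) (ν := (volume : Measure (𝔼 n)))))
  exact ((h1.sub h2).aemeasurable.div
    (measurable_fracDiff_weight.comp measurable_snd).aemeasurable).aestronglyMeasurable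

theorem MemL2Hs.memLp {T : ℝ} {w : ℝ → 𝔼 n → ℝ} (hw : MemL2Hs T s w) :
    MemLp (Function.uncurry w) 2 ((volume.restrict (Ioo 0 T)).prod volume) := by
  rw [memLp_two_uncurry_iff hw.1]
  exact (lintegral_mono fun t => pow_le_pow_left' (eLpNorm_le_hsNorm _) 2).trans_lt hw.2.2

theorem MemL2Hs.memLp_fracDiff {T : ℝ} {w : ℝ → 𝔼 n → ℝ} (hw : MemL2Hs T s w) :
    MemLp (Function.uncurry fun t => fracDiff s (w t)) 2
      ((volume.restrict (Ioo 0 T)).prod volume) := by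
  rw [memLp_two_uncurry_iff (aestronglyMeasurable_uncurry_fracDiff hw.1)]
  exact (lintegral_mono fun t => pow_le_pow_left' (eLpNorm_fracDiff_le_hsNorm _) 2).trans_lt
    hw.2.2

/-- The difference quotient at (x,y) is linear in the values at x and y, hence commutes with the
time integral whenever both values are integrable in time, that is, for almost every pair. -/
theorem fracDiff_timeIntegral {T r : ℝ} (hr : r ≤ T) {w : ℝ → 𝔼 n → ℝ}
    (hw : MemLp (Function.uncurry w) 2 ((volume.restrict (Ioo 0 T)).prod volume)) :
    fracDiff s (timeIntegral w r) =ᵐ[volume] timeIntegral (fun t => fracDiff s (w t)) r := by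
  have h := ae_integrableOn_Ioo (memLp_restrict_Ioo hr hw)
  have h1 : ∀ᵐ p : 𝔼 n × 𝔼 n, IntegrableOn (fun t => w t p.1) (Ioo 0 r) :=
    Measure.quasiMeasurePreserving_fst.ae h
  have h2 : ∀ᵐ p : 𝔼 n × 𝔼 n, IntegrableOn (fun t => w t p.2) (Ioo 0 r) :=
    Measure.quasiMeasurePreserving_snd.ae h
  filter_upwards [h1, h2] with p h1 h2
  simp only [fracDiff, timeIntegral]
  rw [integral_div, integral_sub h1 h2]

theorem kernelDiff_timeIntegral {T r : ℝ} (hr : r ≤ T) {w : ℝ → 𝔼 n → ℝ} (K : 𝔼 n → 𝔼 n → ℝ)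
    (hw : MemLp (Function.uncurry w) 2 ((volume.restrict (Ioo 0 T)).prod volume)) :
    kernelDiff s K (timeIntegral w r) =ᵐ[volume]
      timeIntegral (fun t => kernelDiff s K (w t)) r := by
  filter_upwards [fracDiff_timeIntegral (s := s) hr hw] with p hp
  rw [kernelDiff, hp]
  exact (integral_const_mul _ _).symm

/-- The fractional Poincaré inequality for functions that vanish outside of a bounded set. -/
theorem exists_poincare_const (hn : 1 ≤ n) (hs : 0 < s) {Ω : Set (𝔼 n)} (hΩ : Bornology.IsBounded Ω)
    (hm : MeasurableSet Ω) :
    ∃ C : ℝ, 0 < C ∧ ∀ f : 𝔼 n → ℝ, AEStronglyMeasurable f volume →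
      (∀ᵐ x ∂volume.restrict Ωᶜ, f x = 0) →
      eLpNorm f 2 volume ≤ ENNReal.ofReal C * eLpNorm (fracDiff s f) 2 volume := by
  obtain ⟨R, hR0, hR⟩ := hΩ.subset_ball_lt 0 0
  -- The unit ball B around z misses the ball of radius R that contains Ω, so f = 0 almost
  -- everywhere on B. For x in Ω and y in B the distance is at most D = R + (R + 1) + 1, hence f(x)²
  -- ≤ D^α times the squared difference quotient; integrating over Ω × B gives the claim.
  set z : 𝔼 n := EuclideanSpace.single ⟨0, hn⟩ (R + 1)
  have hz : ‖z‖ = R + 1 := by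
    rw [PiLp.norm_single, Real.norm_of_nonneg (by linarith)]
  set B := Metric.ball z 1
  set α : ℝ := (n : ℝ) + 2 * s
  have hα : 0 ≤ α := by positivity
  set D : ℝ := 2 * R + 2
  have hD : 0 < D := by positivity
  have hBΩ : B ⊆ Ωᶜ := fun y hy hy2 => by
    have h1 := hR hy2
    rw [mem_ball_zero_iff] at h1
    rw [Metric.mem_ball, dist_eq_norm] at hy
    have := norm_sub_norm_le z y
    rw [norm_sub_rev] at this
    linarith
  have hB0 : volume B ≠ 0 := (Metric.measure_ball_pos _ _ one_pos).ne'
  have hBt : volume B ≠ ∞ := measure_ball_lt_top.ne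
  set β := (volume B).toReal
  have hβ : 0 < β := ENNReal.toReal_pos hB0 hBt
  refine ⟨√(D ^ α / β), Real.sqrt_pos.2 (by positivity), fun f hf h0 => le_of_pow_two_le ?_⟩
  rw [mul_pow, ← ENNReal.ofReal_pow (Real.sqrt_nonneg _), Real.sq_sqrt (by positivity)]
  have e1 : eLpNorm f 2 volume ^ 2 = ∫⁻ x in Ω, ENNReal.ofReal (f x ^ 2) := by
    rw [eLpNorm_two_sq, ← lintegral_add_compl _ hm]
    have : ∫⁻ x in Ωᶜ, ENNReal.ofReal (f x ^ 2) = 0 := by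
      rw [lintegral_congr_ae (g := fun _ => 0) (by filter_upwards [h0] with x hx; simp [hx])]
      simp
    rw [this, add_zero]
  have hB : ∀ᵐ y ∂volume.restrict B, f y = 0 :=
    ae_mono (Measure.restrict_mono hBΩ le_rfl) h0
  have e2 : ∫⁻ p, ENNReal.ofReal (f p.1 ^ 2)
      ∂((volume.restrict Ω).prod (volume.restrict B)) =
      volume B * ∫⁻ x in Ω, ENNReal.ofReal (f x ^ 2) := by
    rw [lintegral_prod _ (by
      exact (hf.aemeasurable.restrict.comp_fst.pow_const 2).ennreal_ofReal)]
    simp only [lintegral_const, Measure.restrict_apply_univ]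
    rw [lintegral_mul_const' _ _ hBt, mul_comm]
  have e3 : ∫⁻ p, ENNReal.ofReal (f p.1 ^ 2)
      ∂((volume.restrict Ω).prod (volume.restrict B)) ≤
      ∫⁻ p : 𝔼 n × 𝔼 n, ENNReal.ofReal (D ^ α) * ENNReal.ofReal (fracDiff s f p ^ 2) := by
    rw [Measure.prod_restrict]
    refine (lintegral_mono_ae ?_).trans (setLIntegral_le_lintegral (Ω ×ˢ B) _)
    have h1 : ∀ᵐ p ∂(volume.restrict Ω).prod (volume.restrict B), f p.2 = 0 :=
      Measure.quasiMeasurePreserving_snd.ae hB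
    rw [Measure.prod_restrict] at h1
    filter_upwards [h1, ae_restrict_mem (hm.prod measurableSet_ball)] with p hp hpm
    rw [← ENNReal.ofReal_mul (by positivity), pow_two (fracDiff s f p), fracDiff_mul, hp]
    refine ENNReal.ofReal_le_ofReal ?_
    have hpD : ‖p.1 - p.2‖ ≤ D := by
      have h1 := hR hpm.1
      rw [mem_ball_zero_iff] at h1
      have h2 := hpm.2
      rw [Metric.mem_ball, dist_eq_norm] at h2
      have h3 : p.1 - p.2 = p.1 - (p.2 - z) - z := by abel
      rw [h3]
      have := norm_sub_le (p.1 - (p.2 - z)) z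
      have := norm_sub_le p.1 (p.2 - z)
      linarith
    have hpos : 0 < ‖p.1 - p.2‖ := norm_pos_iff.2 (sub_ne_zero.2 fun h =>
      hBΩ hpm.2 (h ▸ hpm.1))
    rw [sub_zero, ← pow_two, mul_div_assoc', le_div_iff₀ (Real.rpow_pos_of_pos hpos _), mul_comm]
    exact mul_le_mul_of_nonneg_right (Real.rpow_le_rpow hpos.le hpD hα) (sq_nonneg _)
  rw [e2, lintegral_const_mul' _ _ ENNReal.ofReal_ne_top, ← e1, ← eLpNorm_two_sq] at e3
  rw [ENNReal.ofReal_div_of_pos hβ, ENNReal.ofReal_toReal hBt, ENNReal.div_eq_inv_mul, mul_assoc]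
  calc eLpNorm f 2 volume ^ 2 = (volume B)⁻¹ * (volume B * eLpNorm f 2 volume ^ 2) := by
        rw [← mul_assoc, ENNReal.inv_mul_cancel hB0 hBt, one_mul]
    _ ≤ _ := by gcongr

end Gagliardo

/-! ### The closure of the test functions in H^s. -/

section HsTilde

variable {n : ℕ} {s : ℝ} {Ω : Set (EuclideanSpace ℝ (Fin n))}

local notation "𝔼" k:max => EuclideanSpace ℝ (Fin k)

/-- Smooth functions with compact support in `Ω`. -/
structure IsSpaceTestFunction (Ω : Set (𝔼 n)) (ψ : 𝔼 n → ℝ) : Prop where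
  contDiff : ContDiff ℝ (⊤ : ℕ∞) ψ
  hasCompactSupport : HasCompactSupport ψ
  tsupport_subset : tsupport ψ ⊆ Ω

theorem IsSpaceTestFunction.add {ψ χ : 𝔼 n → ℝ} (h : IsSpaceTestFunction Ω ψ)
    (h' : IsSpaceTestFunction Ω χ) : IsSpaceTestFunction Ω (fun x => ψ x + χ x) where
  contDiff := h.contDiff.add h'.contDiff
  hasCompactSupport := h.hasCompactSupport.add h'.hasCompactSupport
  tsupport_subset := (tsupport_add ψ χ).trans (union_subset h.tsupport_subset h'.tsupport_subset)

theorem IsSpaceTestFunction.const_mul {ψ : 𝔼 n → ℝ} (h : IsSpaceTestFunction Ω ψ) (c : ℝ) :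
    IsSpaceTestFunction Ω (fun x => c * ψ x) where
  contDiff := contDiff_const.mul h.contDiff
  hasCompactSupport := h.hasCompactSupport.mul_left
  tsupport_subset := (tsupport_mul_subset_right (f := fun _ => c)).trans h.tsupport_subset

theorem isSpaceTestFunction_zero : IsSpaceTestFunction Ω (fun _ => (0 : ℝ)) where
  contDiff := contDiff_const
  hasCompactSupport := HasCompactSupport.zero
  tsupport_subset := by
    have : tsupport (fun _ : 𝔼 n => (0 : ℝ)) = ∅ := tsupport_eq_empty_iff.2 rfl
    rw [this]
    exact empty_subset _

theorem IsSpaceTestFunction.eq_zero {ψ : 𝔼 n → ℝ} (h : IsSpaceTestFunction Ω ψ) {x : 𝔼 n}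
    (hx : x ∉ Ω) : ψ x = 0 :=
  image_eq_zero_of_notMem_tsupport fun h' => hx (h.tsupport_subset h')

theorem IsSpaceTestFunction.memLp {ψ : 𝔼 n → ℝ} (h : IsSpaceTestFunction Ω ψ) :
    MemLp ψ 2 volume :=
  h.contDiff.continuous.memLp_of_hasCompactSupport h.hasCompactSupport

/-- The difference quotients in `L²` of smooth functions with compact support in `Ω`. -/
def testSpace (Ω : Set (𝔼 n)) (s : ℝ) :
    Submodule ℝ (Lp ℝ 2 (volume : Measure ((𝔼 n) × (𝔼 n)))) where
  carrier := {z | ∃ ψ, IsSpaceTestFunction Ω ψ ∧ z =ᵐ[volume] fracDiff s ψ}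
  zero_mem' := ⟨_, isSpaceTestFunction_zero, by
    filter_upwards [Lp.coeFn_zero ℝ 2 (volume : Measure ((𝔼 n) × (𝔼 n)))] with p hp
    rw [hp]
    simp [fracDiff]⟩
  add_mem' := by
    rintro y z ⟨ψ, hψ, hy⟩ ⟨χ, hχ, hz⟩
    refine ⟨_, hψ.add hχ, ?_⟩
    filter_upwards [Lp.coeFn_add y z, hy, hz] with p h1 h2 h3
    rw [h1, fracDiff_add, Pi.add_apply, h2, h3]
  smul_mem' := by
    rintro c z ⟨ψ, hψ, hz⟩
    refine ⟨_, hψ.const_mul c, ?_⟩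
    filter_upwards [Lp.coeFn_smul c z, hz] with p h1 h2
    rw [h1, fracDiff_const_mul, Pi.smul_apply, h2, smul_eq_mul]

theorem eLpNorm_sub_eq_ofReal_dist {P : Type*} [MeasurableSpace P] {μ : Measure P}
    {y z : Lp ℝ 2 μ} {f g : P → ℝ} (hf : y =ᵐ[μ] f) (hg : z =ᵐ[μ] g) :
    eLpNorm (fun p => f p - g p) 2 μ = ENNReal.ofReal (dist y z) := by
  rw [← edist_dist, Lp.edist_def]
  refine eLpNorm_congr_ae ?_
  filter_upwards [hf, hg] with p h2 h3
  rw [Pi.sub_apply, h2, h3]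

/-- The difference f - ψ vanishes outside Ω, so the Poincaré inequality upgrades closeness of
difference quotients in L² to closeness in the full H^s norm. -/
theorem hsNorm_sub_le_of_poincare {C : ℝ} (hC : 0 < C)
    (hP : ∀ f : 𝔼 n → ℝ, AEStronglyMeasurable f volume →
      (∀ᵐ x ∂volume.restrict Ωᶜ, f x = 0) →
      eLpNorm f 2 volume ≤ ENNReal.ofReal C * eLpNorm (fracDiff s f) 2 volume)
    (hm : MeasurableSet Ω)
    {f ψ : 𝔼 n → ℝ} (hf : AEStronglyMeasurable f volume)
    (h0 : ∀ᵐ x ∂volume.restrict Ωᶜ, f x = 0) (hψ : IsSpaceTestFunction Ω ψ)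
    {y z : Lp ℝ 2 (volume : Measure ((𝔼 n) × (𝔼 n)))}
    (hy : y =ᵐ[volume] fracDiff s f) (hz : z =ᵐ[volume] fracDiff s ψ) :
    hsNorm s (fun x => f x - ψ x) ≤ ENNReal.ofReal ((C + 1) * dist y z) := by
  have h1 : eLpNorm (fracDiff s fun x => f x - ψ x) 2 volume = ENNReal.ofReal (dist y z) := by
    rw [fracDiff_sub]
    exact eLpNorm_sub_eq_ofReal_dist hy hz
  have h2 : ∀ᵐ x ∂volume.restrict Ωᶜ, f x - ψ x = 0 := by
    filter_upwards [h0, ae_restrict_mem hm.compl] with x hx hx2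
    rw [hx, hψ.eq_zero hx2, sub_zero]
  have h3 := hP (fun x => f x - ψ x) (hf.sub hψ.contDiff.continuous.aestronglyMeasurable) h2
  refine (hsNorm_le _).trans ((add_le_add_left h3 _).trans (le_of_eq ?_))
  rw [h1, add_mul, one_mul, ENNReal.ofReal_add (by positivity) (by positivity),
    ENNReal.ofReal_mul hC.le]

theorem MemHsTilde.ae_eq_zero {f : 𝔼 n → ℝ} (hf : MemHsTilde Ω s f) (hm : MeasurableSet Ω) :
    ∀ᵐ x ∂volume.restrict Ωᶜ, f x = 0 := by
  have h1 : eLpNorm f 2 (volume.restrict Ωᶜ) = 0 := by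
    refine le_antisymm (ENNReal.le_of_forall_pos_le_add fun ε hε _ => ?_) (zero_le)
    obtain ⟨ψ, h1, h2, h3, h4⟩ := hf.2 ε hε
    have h5 : eLpNorm f 2 (volume.restrict Ωᶜ) =
        eLpNorm (fun x => f x - ψ x) 2 (volume.restrict Ωᶜ) := by
      refine eLpNorm_congr_ae ?_
      filter_upwards [ae_restrict_mem hm.compl] with x hx
      rw [image_eq_zero_of_notMem_tsupport fun h => hx (h3 h), sub_zero]
    rw [h5, zero_add]
    refine (eLpNorm_mono_measure _ Measure.restrict_le_self).trans
      ((eLpNorm_le_hsNorm (s := s) _).trans (h4.le.trans (le_of_eq ?_)))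
    simp
  exact (eLpNorm_eq_zero_iff hf.1.1.1.restrict (by norm_num)).1 h1

theorem MemHsTilde.toLp_mem_closure {f : 𝔼 n → ℝ} (hf : MemHsTilde Ω s f) :
    (memHs_iff.1 hf.1).2.toLp _ ∈ (testSpace Ω s).topologicalClosure := by
  have hf2 := (memHs_iff.1 hf.1).2
  rw [← SetLike.mem_coe, Submodule.topologicalClosure_coe, Metric.mem_closure_iff]
  intro ε hε
  obtain ⟨ψ, h1, h2, h3, h4⟩ := hf.2 ε hε
  have hψ : IsSpaceTestFunction Ω ψ := ⟨h1, h2, h3⟩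
  have hd : MemLp (fracDiff s fun x => f x - ψ x) 2 volume :=
    ⟨aestronglyMeasurable_fracDiff (hf.1.1.1.sub hψ.contDiff.continuous.aestronglyMeasurable),
      (eLpNorm_fracDiff_le_hsNorm _).trans_lt (h4.trans ENNReal.ofReal_lt_top)⟩
  have hψ2 : MemLp (fracDiff s ψ) 2 volume := by
    refine (hf2.sub hd).ae_eq (.of_forall fun p => ?_)
    rw [Pi.sub_apply, fracDiff_sub, sub_sub_cancel]
  refine ⟨hψ2.toLp _, ⟨ψ, hψ, hψ2.coeFn_toLp⟩, ?_⟩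
  rw [← ENNReal.ofReal_lt_ofReal_iff hε,
    ← eLpNorm_sub_eq_ofReal_dist hf2.coeFn_toLp hψ2.coeFn_toLp, ← fracDiff_sub]
  exact (eLpNorm_fracDiff_le_hsNorm _).trans_lt h4

/-- With `MemHsTilde.toLp_mem_closure`, this describes the closure of the test functions through a
closed subspace of a Hilbert space. Linearity and stability under time integration are inherited
from that subspace. -/
theorem memHsTilde_of_mem_closure (hn : 1 ≤ n) (hs : 0 < s) (hb : Bornology.IsBounded Ω)
    (hm : MeasurableSet Ω) {f : 𝔼 n → ℝ} (hf : MemLp f 2 volume)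
    (h0 : ∀ᵐ x ∂volume.restrict Ωᶜ, f x = 0)
    {z : Lp ℝ 2 (volume : Measure ((𝔼 n) × (𝔼 n)))}
    (hz : z ∈ (testSpace Ω s).topologicalClosure) (hzf : z =ᵐ[volume] fracDiff s f) :
    MemHsTilde Ω s f := by
  obtain ⟨C, hC, hP⟩ := exists_poincare_const hn hs hb hm
  refine ⟨memHs_iff.2 ⟨hf, (Lp.memLp z).ae_eq hzf⟩, fun ε hε => ?_⟩
  rw [← SetLike.mem_coe, Submodule.topologicalClosure_coe, Metric.mem_closure_iff] at hz
  obtain ⟨y, ⟨ψ, hψ, hy⟩, hd⟩ := hz (ε / (C + 1)) (by positivity)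
  refine ⟨ψ, hψ.contDiff, hψ.hasCompactSupport, hψ.tsupport_subset,
    (hsNorm_sub_le_of_poincare hC hP hm hf.1 h0 hψ hzf hy).trans_lt ?_⟩
  rw [ENNReal.ofReal_lt_ofReal_iff hε, mul_comm]
  exact (lt_div_iff₀ (by positivity)).1 hd

theorem MemHsTilde.ae_congr {f g : 𝔼 n → ℝ} (hf : MemHsTilde Ω s f) (h : f =ᵐ[volume] g) :
    MemHsTilde Ω s g := by
  refine ⟨memHs_iff.2 ⟨(memHs_iff.1 hf.1).1.ae_eq h,
    (memHs_iff.1 hf.1).2.ae_eq (fracDiff_ae_congr h)⟩, fun ε hε => ?_⟩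
  obtain ⟨ψ, h1, h2, h3, h4⟩ := hf.2 ε hε
  refine ⟨ψ, h1, h2, h3, ?_⟩
  rwa [← hsNorm_ae_congr (f := fun x => f x - ψ x)]
  filter_upwards [h] with x hx
  rw [hx]

theorem MemHsTilde.sub (hn : 1 ≤ n) (hs : 0 < s) (hb : Bornology.IsBounded Ω)
    (hm : MeasurableSet Ω) {f g : 𝔼 n → ℝ} (hf : MemHsTilde Ω s f) (hg : MemHsTilde Ω s g) :
    MemHsTilde Ω s (fun x => f x - g x) := by
  refine memHsTilde_of_mem_closure hn hs hb hm (hf.1.1.sub hg.1.1) ?_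
    (Submodule.sub_mem _ hf.toLp_mem_closure hg.toLp_mem_closure) ?_
  · filter_upwards [hf.ae_eq_zero hm, hg.ae_eq_zero hm] with x h1 h2
    rw [h1, h2, sub_zero]
  · rw [fracDiff_sub]
    filter_upwards [Lp.coeFn_sub ((memHs_iff.1 hf.1).2.toLp _) ((memHs_iff.1 hg.1).2.toLp _),
      (memHs_iff.1 hf.1).2.coeFn_toLp, (memHs_iff.1 hg.1).2.coeFn_toLp] with p h1 h2 h3
    rw [h1, Pi.sub_apply, h2, h3]

theorem MemHsTilde.const_mul (hn : 1 ≤ n) (hs : 0 < s) (hb : Bornology.IsBounded Ω)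
    (hm : MeasurableSet Ω) {f : 𝔼 n → ℝ} (hf : MemHsTilde Ω s f) (c : ℝ) :
    MemHsTilde Ω s (fun x => c * f x) := by
  refine memHsTilde_of_mem_closure hn hs hb hm (hf.1.1.const_mul c) ?_
    (Submodule.smul_mem _ c hf.toLp_mem_closure) ?_
  · filter_upwards [hf.ae_eq_zero hm] with x h1
    rw [h1, mul_zero]
  · rw [fracDiff_const_mul]
    filter_upwards [Lp.coeFn_smul c ((memHs_iff.1 hf.1).2.toLp _),
      (memHs_iff.1 hf.1).2.coeFn_toLp] with p h1 h2
    rw [h1, Pi.smul_apply, h2, smul_eq_mul]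

theorem MemHsTilde.timeIntegral (hn : 1 ≤ n) (hs : 0 < s) (hb : Bornology.IsBounded Ω)
    (hm : MeasurableSet Ω) {T r : ℝ} (hr : r ≤ T) {q : ℝ → 𝔼 n → ℝ}
    (hq : MemLp (Function.uncurry q) 2 ((volume.restrict (Ioo 0 T)).prod volume))
    (hq2 : MemLp (Function.uncurry fun t => fracDiff s (q t)) 2
      ((volume.restrict (Ioo 0 T)).prod volume))
    (h : ∀ᵐ t ∂volume.restrict (Ioo 0 T), MemHsTilde Ω s (q t)) :
    MemHsTilde Ω s (timeIntegral q r) := by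
  have hH := memLp_timeIntegral hr hq2
  have hr' : ∀ᵐ t ∂volume.restrict (Ioo 0 r), MemHsTilde Ω s (q t) :=
    ae_mono (Measure.restrict_mono (Ioo_subset_Ioo_right hr) le_rfl) h
  refine memHsTilde_of_mem_closure (z := hH.toLp _) hn hs hb hm (memLp_timeIntegral hr hq) ?_ ?_ ?_
  -- Vanishing outside Ω for almost every time is passed through Fubini, so that for almost every
  -- point outside Ω the integrand vanishes for almost every time.
  · have h1 : ∀ᵐ z ∂(volume.restrict Ωᶜ).prod (volume.restrict (Ioo 0 r)), q z.2 z.1 = 0 := by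
      have h0 : AEStronglyMeasurable (Function.uncurry q)
          ((volume.restrict (Ioo 0 r)).prod (volume.restrict Ωᶜ)) :=
        (memLp_restrict_Ioo hr hq).1.mono_measure
          (Measure.prod_mono le_rfl Measure.restrict_le_self)
      have h2 : eLpNorm (Function.uncurry q) 2
          ((volume.restrict (Ioo 0 r)).prod (volume.restrict Ωᶜ)) ^ 2 = 0 := by
        rw [← lintegral_eLpNorm_two_sq h0, lintegral_congr_ae (g := fun _ => 0)]
        · simp
        · filter_upwards [hr'] with t ht
          rw [eLpNorm_congr_ae (g := fun _ => (0 : ℝ)) (ht.ae_eq_zero hm)]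
          simp
      have h3 := (eLpNorm_eq_zero_iff h0 (by norm_num)).1 (pow_eq_zero_iff two_ne_zero |>.1 h2)
      exact Measure.measurePreserving_swap.quasiMeasurePreserving.ae h3
    filter_upwards [Measure.ae_ae_of_ae_prod h1] with x hx
    rw [_root_.timeIntegral, integral_congr_ae hx]
    simp
  -- The closure is the double orthogonal complement, so membership is tested by scalar pairings.
  -- These commute with the time integral and vanish for almost every t.
  · rw [← Submodule.orthogonal_orthogonal_eq_closure, Submodule.mem_orthogonal]
    intro y hy
    rw [L2.inner_def]
    have h1 : ∫ p, inner ℝ (y p) ((hH.toLp _) p) =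
        ∫ p, _root_.timeIntegral (fun t => fracDiff s (q t)) r p * y p := by
      refine integral_congr_ae ?_
      filter_upwards [hH.coeFn_toLp] with p hp
      rw [hp]
      rfl
    rw [h1, integral_timeIntegral_mul hr hq2 (Lp.memLp y), integral_congr_ae (g := fun _ => 0)]
    · simp
    · filter_upwards [hr'] with t ht
      have h2 := ht.toLp_mem_closure
      rw [← Submodule.orthogonal_orthogonal_eq_closure, Submodule.mem_orthogonal] at h2
      rw [← h2 y hy, L2.inner_def]
      refine integral_congr_ae ?_
      filter_upwards [(memHs_iff.1 ht.1).2.coeFn_toLp] with p hp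
      rw [hp]
      rfl
  · filter_upwards [hH.coeFn_toLp, fracDiff_timeIntegral (s := s) hr hq] with p h1 h2
    rw [h1, h2]

/-- The difference quotients of test functions form a subset of a separable L² space. Countability
later allows one null set of times to serve all test functions. -/
theorem exists_countable_dense_testFunctions (hn : 1 ≤ n) (hs : 0 < s)
    (hb : Bornology.IsBounded Ω) (hm : MeasurableSet Ω) :
    ∃ S : Set (𝔼 n → ℝ), S.Countable ∧
      (∀ ψ ∈ S, IsSpaceTestFunction Ω ψ ∧ MemLp (fracDiff s ψ) 2 volume) ∧
      ∀ f, MemHsTilde Ω s f → ∀ ε : ℝ, 0 < ε →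
        ∃ ψ ∈ S, hsNorm s (fun x => f x - ψ x) < ENNReal.ofReal ε := by
  obtain ⟨C, hC, hP⟩ := exists_poincare_const hn hs hb hm
  have : Fact ((2 : ℝ≥0∞) ≠ ∞) := ⟨by norm_num⟩
  have : MeasurableSpace.CountablyGenerated ((𝔼 n) × (𝔼 n)) := inferInstance
  have : SFinite (volume : Measure ((𝔼 n) × (𝔼 n))) := inferInstance
  obtain ⟨B, hBs, hBc, hBd⟩ := (TopologicalSpace.IsSeparable.of_separableSpace
    (testSpace Ω s : Set (Lp ℝ 2 (volume : Measure ((𝔼 n) × (𝔼 n)))))).exists_countable_dense_subset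
  have hch : ∀ z : Lp ℝ 2 (volume : Measure ((𝔼 n) × (𝔼 n))), ∃ ψ : 𝔼 n → ℝ,
      z ∈ B → IsSpaceTestFunction Ω ψ ∧ z =ᵐ[volume] fracDiff s ψ := fun z => by
    by_cases hz : z ∈ B
    · obtain ⟨ψ, h⟩ := hBs hz
      exact ⟨ψ, fun _ => h⟩
    · exact ⟨0, fun h => absurd h hz⟩
  choose Ψ hΨ using hch
  refine ⟨Ψ '' B, hBc.image Ψ, ?_, fun f hf ε hε => ?_⟩
  · rintro _ ⟨z, hz, rfl⟩
    exact ⟨(hΨ z hz).1, (Lp.memLp z).ae_eq (hΨ z hz).2⟩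
  · have h1 := hf.toLp_mem_closure
    rw [← SetLike.mem_coe, Submodule.topologicalClosure_coe] at h1
    have h2 := closure_minimal hBd isClosed_closure h1
    rw [Metric.mem_closure_iff] at h2
    obtain ⟨y, hy, hd⟩ := h2 (ε / (C + 1)) (by positivity)
    refine ⟨Ψ y, mem_image_of_mem _ hy, (hsNorm_sub_le_of_poincare hC hP hm hf.1.1.1
      (hf.ae_eq_zero hm) (hΨ y hy).1 (memHs_iff.1 hf.1).2.coeFn_toLp (hΨ y hy).2).trans_lt ?_⟩
    rw [ENNReal.ofReal_lt_ofReal_iff hε, mul_comm]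
    exact (lt_div_iff₀ (by positivity)).1 hd

end HsTilde

/-! ### The nonlinearity Φ^m. -/

section PorousPhi

variable {m : ℝ}

theorem porousPhi_zero : porousPhi m 0 = 0 := by simp [porousPhi]

theorem measurable_porousPhi : Measurable (porousPhi m) :=
  (measurable_norm.pow_const _).mul measurable_id

theorem abs_le_one_add_abs_porousPhi (hm : 1 < m) (r : ℝ) : |r| ≤ 1 + |porousPhi m r| := by
  rcases le_total |r| 1 with h | h
  · linarith [abs_nonneg (porousPhi m r)]
  · have h1 : 1 ≤ |r| ^ (m - 1) := Real.one_le_rpow h (by linarith)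
    rw [porousPhi, abs_mul, abs_of_nonneg (Real.rpow_nonneg (abs_nonneg r) (m - 1))]
    nlinarith

theorem porousPhi_strictMono (hm : 1 < m) : StrictMono (porousPhi m) := by
  have h0 : StrictMonoOn (porousPhi m) (Ici 0) := fun x hx y hy hxy => by
    rw [mem_Ici] at hx
    have hy' : 0 < y := hx.trans_lt hxy
    simp only [porousPhi, abs_of_nonneg hx, abs_of_pos hy']
    calc x ^ (m - 1) * x ≤ y ^ (m - 1) * x :=
          mul_le_mul_of_nonneg_right (Real.rpow_le_rpow hx hxy.le (by linarith)) hx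
      _ < y ^ (m - 1) * y := mul_lt_mul_of_pos_left hxy (Real.rpow_pos_of_pos hy' _)
  exact strictMono_of_odd_strictMonoOn_nonneg (fun x => by simp [porousPhi]) h0

/-- The measurable left inverse recovers measurability of u from that of Φ^m(u), the only
measurability a weak solution carries by definition. -/
theorem porousPhi_inv_porousPhi (hm : 1 < m) (r : ℝ) : porousPhi m⁻¹ (porousPhi m r) = r := by
  rcases eq_or_ne r 0 with rfl | hr
  · simp [porousPhi_zero]
  have hp : 0 < |r| := abs_pos.2 hr
  have h1 : |porousPhi m r| = |r| ^ m := by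
    rw [porousPhi, abs_mul, abs_of_pos (Real.rpow_pos_of_pos hp _), Real.rpow_sub_one hp.ne',
      div_mul_cancel₀ _ hp.ne']
  rw [porousPhi, h1, porousPhi, ← Real.rpow_mul hp.le, ← mul_assoc, ← Real.rpow_add hp]
  have : m * (m⁻¹ - 1) + (m - 1) = 0 := by
    have : m ≠ 0 := by linarith
    field_simp
    ring
  rw [this, Real.rpow_zero, one_mul]

end PorousPhi

/-! ### The equation integrated in time. -/

section WeakSolution

variable {n : ℕ} {s T m lam Lam : ℝ} {Ω : Set (EuclideanSpace ℝ (Fin n))}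

local notation "𝔼" k:max => EuclideanSpace ℝ (Fin k)

variable {K : EuclideanSpace ℝ (Fin n) → EuclideanSpace ℝ (Fin n) → ℝ}

theorem aestronglyMeasurable_of_porousPhi {P : Type*} [MeasurableSpace P] {μ : Measure P}
    (hm : 1 < m) {f : P → ℝ} (hf : AEStronglyMeasurable (fun p => porousPhi m (f p)) μ) :
    AEStronglyMeasurable f μ := by
  have h := (measurable_porousPhi (m := m⁻¹)).comp_aemeasurable hf.aemeasurable
  refine (h.congr (.of_forall fun p => ?_)).aestronglyMeasurable
  exact porousPhi_inv_porousPhi hm _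

/-- Since |r| ≤ 1 + |Φ^m(r)| and constants are square integrable on a bounded set, u inherits square
integrability on Ω from Φ^m(u). -/
theorem memLp_uncurry_of_porousPhi (hm : 1 < m) (hb : Bornology.IsBounded Ω)
    {u : ℝ → 𝔼 n → ℝ} (hu : MemL2Hs T s fun t x => porousPhi m (u t x)) :
    MemLp (Function.uncurry u) 2 ((volume.restrict (Ioo 0 T)).prod (volume.restrict Ω)) := by
  have : IsFiniteMeasure (volume.restrict Ω) := ⟨by
    rw [Measure.restrict_apply_univ]
    exact hb.measure_lt_top⟩
  have h1 : MemLp (Function.uncurry fun t x => porousPhi m (u t x)) 2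
      ((volume.restrict (Ioo 0 T)).prod (volume.restrict Ω)) :=
    hu.memLp.mono_measure (Measure.prod_mono le_rfl Measure.restrict_le_self)
  have h2 : MemLp (fun _ : ℝ × 𝔼 n => (1 : ℝ)) 2
      ((volume.restrict (Ioo 0 T)).prod (volume.restrict Ω)) := memLp_const 1
  refine (h2.add h1.abs).mono (aestronglyMeasurable_of_porousPhi hm h1.1)
    (.of_forall fun z => ?_)
  simp only [Pi.add_apply, Pi.abs_apply, Real.norm_eq_abs, Function.uncurry]
  exact (abs_le_one_add_abs_porousPhi hm _).trans (le_abs_self _)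

theorem abs_integral_add_integral_kernelDiff_le (hK : IsEllipticKernel lam Lam K)
    {a g : 𝔼 n → ℝ} {b : (𝔼 n) × (𝔼 n) → ℝ} (ha : MemLp a 2 (volume.restrict Ω))
    (hb : MemLp b 2 volume) (hg : MemHs s g) :
    |(∫ x in Ω, a x * g x) + ∫ p, b p * kernelDiff s K g p| ≤
      ((eLpNorm a 2 (volume.restrict Ω)).toReal + (eLpNorm b 2 volume).toReal * √Lam) *
        (hsNorm s g).toReal := by
  have hg' := memHs_iff.1 hg
  have hfin := hg.hsNorm_lt_top.ne
  have h1 := abs_integral_mul_le ha (hg'.1.restrict Ω)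
  have h2 := abs_integral_mul_le hb (hK.memLp_kernelDiff hg'.2)
  have h3 : (eLpNorm g 2 (volume.restrict Ω)).toReal ≤ (hsNorm s g).toReal :=
    ENNReal.toReal_mono hfin ((eLpNorm_mono_measure _ Measure.restrict_le_self).trans
      (eLpNorm_le_hsNorm g))
  have h4 : (eLpNorm (kernelDiff s K g) 2 volume).toReal ≤ √Lam * (hsNorm s g).toReal := by
    have := ENNReal.toReal_mono (ENNReal.mul_ne_top ENNReal.ofReal_ne_top hfin)
      ((hK.eLpNorm_kernelDiff_le (s := s) g).trans
        (mul_le_mul_right (eLpNorm_fracDiff_le_hsNorm g) _))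
    rwa [ENNReal.toReal_mul, ENNReal.toReal_ofReal (Real.sqrt_nonneg _)] at this
  refine (abs_add_le _ _).trans ?_
  rw [add_mul, mul_assoc]
  exact add_le_add (h1.trans (mul_le_mul_of_nonneg_left h3 ENNReal.toReal_nonneg))
    (h2.trans (mul_le_mul_of_nonneg_left h4 ENNReal.toReal_nonneg))

theorem IsSpaceTestFunction.isTestFunction_mul {ψ : 𝔼 n → ℝ} (hψ : IsSpaceTestFunction Ω ψ)
    {η : ℝ → ℝ} (h1 : ContDiff ℝ (⊤ : ℕ∞) η) (h2 : HasCompactSupport η)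
    (h3 : tsupport η ⊆ Iio T) : IsTestFunction Ω T fun t x => η t * ψ x := by
  have hsub : tsupport (Function.uncurry fun t x => η t * ψ x) ⊆ tsupport η ×ˢ tsupport ψ := by
    refine closure_minimal (fun z hz => ?_) ((isClosed_tsupport η).prod (isClosed_tsupport ψ))
    simp only [Function.uncurry, Function.mem_support] at hz
    exact ⟨subset_tsupport _ (left_ne_zero_of_mul hz), subset_tsupport _ (right_ne_zero_of_mul hz)⟩
  refine ⟨?_, ?_, hsub.trans (prod_mono h3 hψ.tsupport_subset)⟩
  · exact (h1.comp contDiff_fst).mul (hψ.contDiff.comp contDiff_snd)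
  · exact (h2.isCompact.prod hψ.hasCompactSupport.isCompact).of_isClosed_subset
      (isClosed_tsupport _) hsub

variable {u₀ : EuclideanSpace ℝ (Fin n) → ℝ} {φ u : ℝ → EuclideanSpace ℝ (Fin n) → ℝ}

/-- Testing with products η(t)ψ(x) reduces the weak formulation to a scalar weak equation in t,
which `ae_add_integral_eq_of_weak_deriv` integrates. -/
theorem IsWeakSolution.ae_integral_eq_of_testFunction (hT : 0 < T) (hm : 1 < m)
    (hb : Bornology.IsBounded Ω) (hK : IsEllipticKernel lam Lam K) (hlam : 0 < lam)
    (hu : IsWeakSolution Ω T s m K u₀ φ u) {ψ : 𝔼 n → ℝ} (hψ : IsSpaceTestFunction Ω ψ)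
    (hψ2 : MemLp (fracDiff s ψ) 2 volume) :
    ∀ᵐ t ∂volume.restrict (Ioo 0 T), (∫ x in Ω, u t x * ψ x) +
      ∫ p, timeIntegral (fun τ => kernelDiff s K fun x => porousPhi m (u τ x)) t p *
        kernelDiff s K ψ p = ∫ x in Ω, u₀ x * ψ x := by
  set h : ℝ → (𝔼 n) × (𝔼 n) → ℝ := fun τ => kernelDiff s K fun x => porousPhi m (u τ x)
  have hh : MemLp (Function.uncurry h) 2 ((volume.restrict (Ioo 0 T)).prod volume) :=
    hK.memLp_uncurry_kernelDiff hu.memL2Hs.memLp_fracDiff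
  have hκ := hK.memLp_kernelDiff hψ2
  have hu2 := memLp_uncurry_of_porousPhi (Ω := Ω) hm hb hu.memL2Hs
  have hψr : MemLp ψ 2 (volume.restrict Ω) := hψ.memLp.restrict _
  have huψ : Integrable (fun z : ℝ × 𝔼 n => u z.1 z.2 * ψ z.2)
      ((volume.restrict (Ioo 0 T)).prod (volume.restrict Ω)) :=
    integrable_mul_of_memLp_two hu2 (memLp_uncurry_const hψr)
  have ha : IntegrableOn (fun t => ∫ x in Ω, u t x * ψ x) (Ioo 0 T) := huψ.integral_prod_left
  have hbi : IntegrableOn (fun t => ∫ p, h t p * kernelDiff s K ψ p) (Ioo 0 T) :=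
    integrable_integral_mul hh (memLp_uncurry_const hκ)
  have key := ae_add_integral_eq_of_weak_deriv hT (c := ∫ x in Ω, u₀ x * ψ x) ha hbi
    fun η h1 h2 h3 => ?_
  · filter_upwards [key, ae_restrict_mem measurableSet_Ioo] with t ht htT
    rw [integral_timeIntegral_mul htT.2.le hh hκ]
    exact ht
  have hw := hu.weak_form _ (hψ.isTestFunction_mul h1 h2 h3)
  have hηd : Continuous (deriv η) := h1.continuous_deriv (by exact_mod_cast le_top)
  obtain ⟨M, hM⟩ : ∃ M, ∀ x, ‖deriv η x‖ ≤ M := hηd.bounded_above_of_compact_support h2.deriv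
  have e1 : ∫ p in Ioo 0 T ×ˢ Ω, u p.1 p.2 * deriv (fun τ => η τ * ψ p.2) p.1 =
      ∫ t in Ioo 0 T, (∫ x in Ω, u t x * ψ x) * deriv η t := by
    have : Integrable (fun z : ℝ × 𝔼 n => u z.1 z.2 * ψ z.2 * deriv η z.1)
        ((volume.restrict (Ioo 0 T)).prod (volume.restrict Ω)) :=
      huψ.mul_bdd (hηd.comp continuous_fst).aestronglyMeasurable (.of_forall fun z => hM z.1)
    simp_rw [← integral_mul_const]
    rw [Measure.volume_eq_prod, ← Measure.prod_restrict, ← integral_prod _ this]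
    refine integral_congr_ae (.of_forall fun z => ?_)
    simp only [deriv_mul_const_field]
    ring
  have e2 : ∫ t in Ioo 0 T, bilinForm s K (fun x => porousPhi m (u t x)) (fun x => η t * ψ x) =
      ∫ t in Ioo 0 T, η t * ∫ p, h t p * kernelDiff s K ψ p := by
    refine integral_congr_ae (.of_forall fun t => ?_)
    simp only
    rw [bilinForm_eq (hK.nonneg hlam), ← integral_const_mul, kernelDiff_const_mul]
    refine integral_congr_ae (.of_forall fun p => ?_)
    simp only [h]
    ring
  have e3 : ∫ x in Ω, u₀ x * (η 0 * ψ x) = η 0 * ∫ x in Ω, u₀ x * ψ x := by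
    rw [← integral_const_mul]
    refine integral_congr_ae (.of_forall fun x => ?_)
    simp only
    ring
  rw [e1, e2, e3] at hw
  exact hw

/-- The exceptional null set of times must not depend on f, because f will be taken to depend on t.
The identity holds off one null set for a countable dense family, and both sides are continuous in f
for the H^s norm. -/
theorem IsWeakSolution.ae_forall_integral_eq (hn : 1 ≤ n) (hs : 0 < s) (hT : 0 < T) (hm : 1 < m)
    (hb : Bornology.IsBounded Ω) (hΩ : MeasurableSet Ω) (hK : IsEllipticKernel lam Lam K)
    (hlam : 0 < lam) (hu : IsWeakSolution Ω T s m K u₀ φ u)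
    (hu₀ : MemLp u₀ 2 (volume.restrict Ω)) :
    ∀ᵐ t ∂volume.restrict (Ioo 0 T), ∀ f, MemHsTilde Ω s f → (∫ x in Ω, u t x * f x) +
      ∫ p, timeIntegral (fun τ => kernelDiff s K fun x => porousPhi m (u τ x)) t p *
        kernelDiff s K f p = ∫ x in Ω, u₀ x * f x := by
  obtain ⟨S, hSc, hS, hSd⟩ := exists_countable_dense_testFunctions hn hs hb hΩ
  have h1 : ∀ᵐ t ∂volume.restrict (Ioo 0 T), ∀ ψ ∈ S, (∫ x in Ω, u t x * ψ x) +
      ∫ p, timeIntegral (fun τ => kernelDiff s K fun x => porousPhi m (u τ x)) t p *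
        kernelDiff s K ψ p = ∫ x in Ω, u₀ x * ψ x :=
    (ae_ball_iff hSc).2 fun ψ hψ =>
      hu.ae_integral_eq_of_testFunction hT hm hb hK hlam (hS ψ hψ).1 (hS ψ hψ).2
  have hh := hK.memLp_uncurry_kernelDiff hu.memL2Hs.memLp_fracDiff
  filter_upwards [h1, ae_memLp_of_uncurry (memLp_uncurry_of_porousPhi (Ω := Ω) hm hb hu.memL2Hs),
    ae_restrict_mem measurableSet_Ioo] with t ht hut htT f hf
  have hH := memLp_timeIntegral htT.2.le hh
  set H := timeIntegral (fun τ => kernelDiff s K fun x => porousPhi m (u τ x)) t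
  set a : 𝔼 n → ℝ := fun x => u t x - u₀ x
  have ha : MemLp a 2 (volume.restrict Ω) := hut.sub hu₀
  have hsplit : ∀ g, MemHs s g → (∫ x in Ω, a x * g x) =
      (∫ x in Ω, u t x * g x) - ∫ x in Ω, u₀ x * g x := fun g hg => by
    have hg' := (memHs_iff.1 hg).1.restrict Ω
    rw [← integral_sub (integrable_mul_of_memLp_two hut hg') (integrable_mul_of_memLp_two hu₀ hg')]
    simp only [a, sub_mul]
  set M := (eLpNorm a 2 (volume.restrict Ω)).toReal + (eLpNorm H 2 volume).toReal * √Lam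
  have hM : 0 ≤ M := by positivity
  have hbound : ∀ ε : ℝ, 0 < ε →
      |(∫ x in Ω, a x * f x) + ∫ p, H p * kernelDiff s K f p| ≤ M * ε := fun ε hε => by
    obtain ⟨ψ, hψ, hd⟩ := hSd f hf ε hε
    have hψH : MemHs s ψ := memHs_iff.2 ⟨(hS ψ hψ).1.memLp, (hS ψ hψ).2⟩
    have hfψ : MemHs s fun x => f x - ψ x := by
      refine memHs_iff.2 ⟨hf.1.1.sub hψH.1, ?_⟩
      rw [fracDiff_sub]
      exact (memHs_iff.1 hf.1).2.sub (hS ψ hψ).2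
    have h2 := abs_integral_add_integral_kernelDiff_le hK ha hH hfψ
    have e1 : ∫ x in Ω, a x * (f x - ψ x) = (∫ x in Ω, a x * f x) - ∫ x in Ω, a x * ψ x := by
      rw [← integral_sub (integrable_mul_of_memLp_two ha (hf.1.1.restrict Ω))
        (integrable_mul_of_memLp_two ha (hψH.1.restrict Ω))]
      simp only [mul_sub]
    have e2 : ∫ p, H p * kernelDiff s K (fun x => f x - ψ x) p =
        (∫ p, H p * kernelDiff s K f p) - ∫ p, H p * kernelDiff s K ψ p := by
      rw [← integral_sub
        (integrable_mul_of_memLp_two hH (hK.memLp_kernelDiff (memHs_iff.1 hf.1).2))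
        (integrable_mul_of_memLp_two hH (hK.memLp_kernelDiff (hS ψ hψ).2)), kernelDiff_sub]
      simp only [mul_sub]
    rw [e1, e2, hsplit ψ hψH] at h2
    have h3 := ht ψ hψ
    have h4 : (hsNorm s fun x => f x - ψ x).toReal ≤ ε :=
      ENNReal.toReal_le_of_le_ofReal hε.le hd.le
    refine le_trans (le_of_eq ?_) (h2.trans (mul_le_mul_of_nonneg_left h4 hM))
    congr 1
    linarith
  have h0 : |(∫ x in Ω, a x * f x) + ∫ p, H p * kernelDiff s K f p| ≤ 0 := by
    refine le_of_forall_pos_le_add fun ε hε => ?_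
    refine (hbound (ε / (M + 1)) (by positivity)).trans ?_
    rw [zero_add, mul_div_assoc', div_le_iff₀ (by positivity)]
    nlinarith
  have h5 := abs_nonpos_iff.1 h0
  rw [hsplit f hf.1] at h5
  linarith

end WeakSolution

/-! ### The energy estimate. -/

theorem timeIntegral_sub {P : Type*} [MeasurableSpace P] {μ : Measure P} [SigmaFinite μ] {T t : ℝ}
    (ht : t ≤ T) {h k : ℝ → P → ℝ}
    (hh : MemLp (Function.uncurry h) 2 ((volume.restrict (Ioo 0 T)).prod μ))
    (hk : MemLp (Function.uncurry k) 2 ((volume.restrict (Ioo 0 T)).prod μ)) :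
    timeIntegral (fun τ p => h τ p - k τ p) t =ᵐ[μ]
      fun p => timeIntegral h t p - timeIntegral k t p := by
  filter_upwards [ae_integrableOn_Ioo (memLp_restrict_Ioo ht hh),
    ae_integrableOn_Ioo (memLp_restrict_Ioo ht hk)] with p h1 h2
  exact integral_sub h1 h2

/-- A family of nonnegative numbers whose squares are controlled by a linear function of their
supremum is bounded. -/
theorem le_mul_of_forall_sq_le {S : Set ℝ} {a : ℝ → ℝ} {c Z B : ℝ} (hc : 0 ≤ c) (hZ : 0 ≤ Z)
    (ha : ∀ r ∈ S, 0 ≤ a r) (hB : ∀ r ∈ S, a r ≤ B)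
    (h : ∀ A, 0 ≤ A → (∀ r ∈ S, a r ≤ A) → ∀ r ∈ S, a r ^ 2 ≤ c * (A * Z + Z ^ 2)) :
    ∀ r ∈ S, a r ≤ (c + 1) * Z := by
  intro r hr
  set A := sSup (a '' S)
  -- The value of B is irrelevant; it only makes the supremum A finite, so that the hypothesis can
  -- be applied with A itself. If A exceeded (c + 1)Z, then A² would exceed c(AZ + Z²).
  have hbdd : BddAbove (a '' S) := ⟨B, by rintro _ ⟨t, ht, rfl⟩; exact hB t ht⟩
  have hA : ∀ t ∈ S, a t ≤ A := fun t ht => le_csSup hbdd (mem_image_of_mem _ ht)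
  have hA0 : 0 ≤ A := (ha r hr).trans (hA r hr)
  have h1 : A ≤ √(c * (A * Z + Z ^ 2)) := by
    refine csSup_le ⟨_, mem_image_of_mem _ hr⟩ ?_
    rintro _ ⟨t, ht, rfl⟩
    exact Real.le_sqrt_of_sq_le (h A hA0 hA t ht)
  have h2 : A ^ 2 ≤ c * (A * Z + Z ^ 2) := by
    rw [← Real.sq_sqrt (show 0 ≤ c * (A * Z + Z ^ 2) by positivity)]
    exact pow_le_pow_left₀ hA0 h1 2
  refine (hA r hr).trans ?_
  by_contra hcon
  push Not at hcon
  nlinarith [mul_nonneg hc hZ, mul_nonneg hc hA0]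

section Estimates

variable {n : ℕ} {s T m lam Lam : ℝ} {Ω : Set (EuclideanSpace ℝ (Fin n))}

local notation "𝔼" k:max => EuclideanSpace ℝ (Fin k)

variable {K : EuclideanSpace ℝ (Fin n) → EuclideanSpace ℝ (Fin n) → ℝ}

theorem hsNorm_const_mul (c : ℝ) (f : 𝔼 n → ℝ) :
    hsNorm s (fun x => c * f x) = ‖c‖ₑ * hsNorm s f := by
  have h : ∀ {P : Type} [MeasurableSpace P] {μ : Measure P} (f : P → ℝ),
      eLpNorm (fun x => c * f x) 2 μ = ‖c‖ₑ * eLpNorm f 2 μ := fun f =>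
    eLpNorm_const_smul c f 2 _
  have h2 : hsNorm s (fun x => c * f x) ^ 2 = (‖c‖ₑ * hsNorm s f) ^ 2 := by
    rw [hsNorm_sq, mul_pow, hsNorm_sq, fracDiff_const_mul, h, h, mul_pow, mul_pow, mul_add]
  exact le_antisymm (le_of_pow_two_le h2.le) (le_of_pow_two_le h2.ge)

open Classical in
theorem abs_integral_le_hNegNorm (hn : 1 ≤ n) (hs : 0 < s) (hb : Bornology.IsBounded Ω)
    (hm : MeasurableSet Ω) {w f : 𝔼 n → ℝ} (hw : hNegNorm Ω s w ≠ ∞) (hf : MemHsTilde Ω s f) :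
    |∫ x in Ω, w x * f x| ≤ (hNegNorm Ω s w).toReal * (hsNorm s f).toReal := by
  have hfin := hf.1.hsNorm_lt_top.ne
  -- A function of norm zero cannot be normalised, but it vanishes almost everywhere.
  rcases eq_or_ne (hsNorm s f) 0 with h0 | h0
  · have h1 : eLpNorm f 2 (volume.restrict Ω) = 0 := le_antisymm
      ((eLpNorm_mono_measure _ Measure.restrict_le_self).trans
        ((eLpNorm_le_hsNorm f).trans h0.le)) zero_le
    have h2 := (eLpNorm_eq_zero_iff hf.1.1.1.restrict (by norm_num)).1 h1
    rw [integral_congr_ae (g := fun _ => 0)]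
    · simp [h0]
    · filter_upwards [h2] with x hx
      simp [hx]
  set a := (hsNorm s f).toReal
  have ha : 0 < a := ENNReal.toReal_pos h0 hfin
  have hg : MemHsTilde Ω s fun x => a⁻¹ * f x := hf.const_mul hn hs hb hm a⁻¹
  have hg1 : hsNorm s (fun x => a⁻¹ * f x) ≤ 1 := by
    rw [hsNorm_const_mul, enorm_inv ha.ne', Real.enorm_of_nonneg ha.le, ENNReal.ofReal_toReal hfin,
      ENNReal.inv_mul_cancel h0 hfin]
  have h1 : (if IntegrableOn (fun x => w x * (a⁻¹ * f x)) Ω then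
      ENNReal.ofReal |∫ x in Ω, w x * (a⁻¹ * f x)| else ∞) ≤ hNegNorm Ω s w := by
    unfold hNegNorm
    exact le_iSup₂_of_le _ hg (le_iSup_of_le hg1 le_rfl)
  split_ifs at h1 with h2
  · have h3 := (ENNReal.ofReal_le_iff_le_toReal hw).1 h1
    have h4 : ∫ x in Ω, w x * (a⁻¹ * f x) = a⁻¹ * ∫ x in Ω, w x * f x := by
      rw [← integral_const_mul]
      refine integral_congr_ae (.of_forall fun x => ?_)
      simp only
      ring
    rw [h4, abs_mul, abs_of_pos (inv_pos.2 ha), inv_mul_le_iff₀ ha] at h3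
    rwa [mul_comm]
  · exact absurd (top_le_iff.1 h1) hw

theorem hNegNorm_le {w : 𝔼 n → ℝ} (hw : MemLp w 2 (volume.restrict Ω)) {M : ℝ}
    (h : ∀ f, MemHsTilde Ω s f → hsNorm s f ≤ 1 → |∫ x in Ω, w x * f x| ≤ M) :
    hNegNorm Ω s w ≤ ENNReal.ofReal M := by
  unfold hNegNorm
  refine iSup_le fun f => iSup₂_le fun hf hf1 => ?_
  have hi : IntegrableOn (fun x => w x * f x) Ω :=
    integrable_mul_of_memLp_two hw (hf.1.1.restrict Ω)
  rw [if_pos hi]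
  exact ENNReal.ofReal_le_ofReal (h f hf hf1)

/-- The energy inequality obtained by testing the time integrated equation with `V - g`. -/
theorem energy_inequality (hK : IsEllipticKernel lam Lam K)
    {V g w : ℝ → 𝔼 n → ℝ} {w₀ : 𝔼 n → ℝ}
    (hV : MemLp (Function.uncurry V) 2 ((volume.restrict (Ioo 0 T)).prod volume))
    (hV' : MemLp (Function.uncurry fun t => fracDiff s (V t)) 2
      ((volume.restrict (Ioo 0 T)).prod volume))
    (hg : MemLp (Function.uncurry g) 2 ((volume.restrict (Ioo 0 T)).prod volume))
    (hg' : MemLp (Function.uncurry fun t => fracDiff s (g t)) 2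
      ((volume.restrict (Ioo 0 T)).prod volume))
    (hq : ∀ᵐ t ∂volume.restrict (Ioo 0 T), MemHsTilde Ω s fun x => V t x - g t x)
    (hmon : ∀ᵐ t ∂volume.restrict (Ioo 0 T), 0 ≤ ∫ x in Ω, w t x * (V t x - g t x))
    (hw₀ : MemLp w₀ 2 (volume.restrict Ω))
    (hid : ∀ᵐ t ∂volume.restrict (Ioo 0 T), ∀ f, MemHsTilde Ω s f → (∫ x in Ω, w t x * f x) +
      ∫ p, timeIntegral (fun τ => kernelDiff s K (V τ)) t p * kernelDiff s K f p =
        ∫ x in Ω, w₀ x * f x) {r : ℝ} (hr : r ∈ Ioo 0 T) :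
    2⁻¹ * (eLpNorm (timeIntegral (fun τ => kernelDiff s K (V τ)) r) 2 volume).toReal ^ 2 ≤
      (∫ t in Ioo 0 r, ∫ p, timeIntegral (fun τ => kernelDiff s K (V τ)) t p *
        kernelDiff s K (g t) p) +
      ∫ x in Ω, w₀ x * timeIntegral (fun τ x => V τ x - g τ x) r x := by
  set h : ℝ → (𝔼 n) × (𝔼 n) → ℝ := fun τ => kernelDiff s K (V τ)
  have hh : MemLp (Function.uncurry h) 2 ((volume.restrict (Ioo 0 T)).prod volume) :=
    hK.memLp_uncurry_kernelDiff hV'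
  have hk : MemLp (Function.uncurry fun τ => kernelDiff s K (g τ)) 2
      ((volume.restrict (Ioo 0 T)).prod volume) := hK.memLp_uncurry_kernelDiff hg'
  have hrT := hr.2.le
  have hH := memLp_uncurry_timeIntegral hh
  have hqΩ : MemLp (Function.uncurry fun τ x => V τ x - g τ x) 2
      ((volume.restrict (Ioo 0 T)).prod (volume.restrict Ω)) :=
    (hV.sub hg).mono_measure (Measure.prod_mono le_rfl Measure.restrict_le_self)
  have i1 := integrable_integral_mul (memLp_restrict_Ioo hrT hH) (memLp_restrict_Ioo hrT hh)
  have i2 := integrable_integral_mul (memLp_restrict_Ioo hrT hH) (memLp_restrict_Ioo hrT hk)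
  have i3 := integrable_integral_mul (memLp_restrict_Ioo hrT hqΩ)
    (memLp_uncurry_const (ρ := volume.restrict (Ioo 0 r)) hw₀)
  have e1 : ∫ x in Ω, w₀ x * timeIntegral (fun τ x => V τ x - g τ x) r x =
      ∫ t in Ioo 0 r, ∫ x in Ω, (V t x - g t x) * w₀ x := by
    rw [← integral_timeIntegral_mul hrT hqΩ hw₀]
    simp only [mul_comm]
  rw [← integral_timeIntegral_mul_self hr.1.le hrT hh, e1, ← integral_add i2 i3]
  refine integral_mono_ae i1 (i2.add i3) ?_
  have hsub : volume.restrict (Ioo 0 r) ≤ volume.restrict (Ioo 0 T) :=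
    Measure.restrict_mono (Ioo_subset_Ioo_right hrT) le_rfl
  filter_upwards [ae_mono hsub hq, ae_mono hsub hmon, ae_mono hsub hid,
    ae_mono hsub (ae_memLp_of_uncurry hH), ae_mono hsub (ae_memLp_of_uncurry hh),
    ae_mono hsub (ae_memLp_of_uncurry hk)] with t h1 h2 h3 h4 h5 h6
  -- The time-dependent choice f = V(t) - g(t). The term with w is nonnegative by `hmon` and is
  -- discarded.
  have h7 := h3 _ h1
  have e2 : ∫ p, timeIntegral h t p * kernelDiff s K (fun x => V t x - g t x) p =
      (∫ p, timeIntegral h t p * h t p) - ∫ p, timeIntegral h t p * kernelDiff s K (g t) p := by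
    rw [← integral_sub (integrable_mul_of_memLp_two h4 h5) (integrable_mul_of_memLp_two h4 h6),
      kernelDiff_sub]
    simp only [mul_sub, h]
  have e3 : ∫ x in Ω, (V t x - g t x) * w₀ x = ∫ x in Ω, w₀ x * (V t x - g t x) := by
    simp only [mul_comm]
  rw [e2] at h7
  simp only [e3]
  linarith

/-- The primitive is bounded uniformly in time by A, which leaves only the L¹ norm in time for g. -/
theorem abs_integral_timeIntegral_mul_kernelDiff_le (hK : IsEllipticKernel lam Lam K)
    {h : ℝ → (𝔼 n) × (𝔼 n) → ℝ} {g : ℝ → 𝔼 n → ℝ} {A r : ℝ} (hA : 0 ≤ A) (hr : r ≤ T)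
    (hh : MemLp (Function.uncurry h) 2 ((volume.restrict (Ioo 0 T)).prod volume))
    (hg' : MemLp (Function.uncurry fun t => fracDiff s (g t)) 2
      ((volume.restrict (Ioo 0 T)).prod volume))
    (hhA : ∀ t ∈ Ioo 0 T, (eLpNorm (timeIntegral h t) 2 volume).toReal ≤ A)
    (hΓ : l1HsNorm T s g ≠ ∞) :
    |∫ t in Ioo 0 r, ∫ p, timeIntegral h t p * kernelDiff s K (g t) p| ≤
      A * √Lam * (l1HsNorm T s g).toReal := by
  have hsub : volume.restrict (Ioo 0 r) ≤ volume.restrict (Ioo 0 T) :=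
    Measure.restrict_mono (Ioo_subset_Ioo_right hr) le_rfl
  have h1 : ‖∫ t in Ioo 0 r, ∫ p, timeIntegral h t p * kernelDiff s K (g t) p‖ₑ ≤
      ∫⁻ t in Ioo 0 T, ENNReal.ofReal (A * √Lam) * hsNorm s (g t) := by
    refine (enorm_integral_le_lintegral_enorm _).trans ((lintegral_mono' hsub le_rfl).trans
      (lintegral_mono_ae ?_))
    filter_upwards [ae_memLp_of_uncurry hg', ae_restrict_mem measurableSet_Ioo] with t h2 ht
    have hH := memLp_timeIntegral ht.2.le hh
    have h3 := abs_integral_mul_le hH (hK.memLp_kernelDiff h2)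
    rw [Real.enorm_eq_ofReal_abs]
    refine (ENNReal.ofReal_le_ofReal h3).trans ?_
    rw [ENNReal.ofReal_mul ENNReal.toReal_nonneg,
      ENNReal.ofReal_toReal (hK.memLp_kernelDiff h2).2.ne, ENNReal.ofReal_mul hA, mul_assoc]
    exact mul_le_mul' (ENNReal.ofReal_le_ofReal (hhA t ht))
      ((hK.eLpNorm_kernelDiff_le _).trans (mul_le_mul_right (eLpNorm_fracDiff_le_hsNorm _) _))
  rw [lintegral_const_mul' _ _ ENNReal.ofReal_ne_top, Real.enorm_eq_ofReal_abs] at h1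
  have h2 := (ENNReal.ofReal_le_iff_le_toReal
    (ENNReal.mul_ne_top ENNReal.ofReal_ne_top hΓ)).1 h1
  rwa [ENNReal.toReal_mul, ENNReal.toReal_ofReal (by positivity)] at h2

theorem eLpNorm_timeIntegral_le_l1HsNorm {g : ℝ → 𝔼 n → ℝ} {r : ℝ} (hr : r ≤ T)
    (hg : MemLp (Function.uncurry g) 2 ((volume.restrict (Ioo 0 T)).prod volume)) :
    eLpNorm (timeIntegral g r) 2 volume ≤ l1HsNorm T s g :=
  (eLpNorm_timeIntegral_le hr hg).trans (lintegral_mono fun _ => eLpNorm_le_hsNorm _)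

theorem eLpNorm_fracDiff_timeIntegral_le_l1HsNorm {g : ℝ → 𝔼 n → ℝ} {r : ℝ} (hr : r ≤ T)
    (hg : MemLp (Function.uncurry g) 2 ((volume.restrict (Ioo 0 T)).prod volume))
    (hg' : MemLp (Function.uncurry fun t => fracDiff s (g t)) 2
      ((volume.restrict (Ioo 0 T)).prod volume)) :
    eLpNorm (fracDiff s (timeIntegral g r)) 2 volume ≤ l1HsNorm T s g := by
  rw [eLpNorm_congr_ae (fracDiff_timeIntegral hr hg)]
  exact (eLpNorm_timeIntegral_le hr hg').trans
    (lintegral_mono fun _ => eLpNorm_fracDiff_le_hsNorm _)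

/-- The stability estimates that follow from the time integrated equation. -/
theorem exists_stability_const (hn : 1 ≤ n) (hs : 0 < s) (hb : Bornology.IsBounded Ω)
    (hm : MeasurableSet Ω) (T Lam : ℝ) (hlam : 0 < lam) :
    ∃ C : ℝ, 0 < C ∧ ∀ K : 𝔼 n → 𝔼 n → ℝ, IsEllipticKernel lam Lam K →
      ∀ (V g w : ℝ → 𝔼 n → ℝ) (w₀ : 𝔼 n → ℝ),
      MemLp (Function.uncurry V) 2 ((volume.restrict (Ioo 0 T)).prod volume) →
      MemLp (Function.uncurry fun t => fracDiff s (V t)) 2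
        ((volume.restrict (Ioo 0 T)).prod volume) →
      MemLp (Function.uncurry g) 2 ((volume.restrict (Ioo 0 T)).prod volume) →
      MemLp (Function.uncurry fun t => fracDiff s (g t)) 2
        ((volume.restrict (Ioo 0 T)).prod volume) →
      MemLp (Function.uncurry w) 2 ((volume.restrict (Ioo 0 T)).prod (volume.restrict Ω)) →
      (∀ᵐ t ∂volume.restrict (Ioo 0 T), MemHsTilde Ω s fun x => V t x - g t x) →
      (∀ᵐ t ∂volume.restrict (Ioo 0 T), 0 ≤ ∫ x in Ω, w t x * (V t x - g t x)) →
      MemLp w₀ 2 (volume.restrict Ω) →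
      (∀ᵐ t ∂volume.restrict (Ioo 0 T), ∀ f, MemHsTilde Ω s f → (∫ x in Ω, w t x * f x) +
        ∫ p, timeIntegral (fun τ => kernelDiff s K (V τ)) t p * kernelDiff s K f p =
          ∫ x in Ω, w₀ x * f x) →
      hNegNorm Ω s w₀ ≠ ∞ → l1HsNorm T s g ≠ ∞ →
      lInftyHNegNorm Ω T s w ≤ ENNReal.ofReal
        (C * ((hNegNorm Ω s w₀).toReal + (l1HsNorm T s g).toReal)) ∧
      lInftyHsNorm T s (timeIntegral V) ≤ ENNReal.ofReal
        (C * ((hNegNorm Ω s w₀).toReal + (l1HsNorm T s g).toReal)) := by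
  obtain ⟨P, hP0, hP⟩ := exists_poincare_const hn hs hb hm
  set l := (√lam)⁻¹
  have hl : 0 ≤ l := by positivity
  -- The factor 2 undoes the ½ in the energy inequality. The term √Lam comes from the pairing with
  -- g, the other two from pairing w₀ with ∫₀ʳ (V - g), whose H^s norm is at most (P + 1)(l a(r) +
  -- γ). In C, the first bracket serves the dual norm and the rest serves the H^s norm.
  set c := 2 * (√Lam + (P + 1) * l + (P + 1))
  have hc : 0 ≤ c := by positivity
  set C := (1 + √Lam * (c + 1)) + ((P + 1) * (l * (c + 1) + 1) + 1 + l * (c + 1))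
  refine ⟨C, by positivity, ?_⟩
  intro K hK V g w w₀ hV hV' hg hg' hw hq hmon hw₀ hid hN hΓ
  set ν := (hNegNorm Ω s w₀).toReal
  set γ := (l1HsNorm T s g).toReal
  have hν : 0 ≤ ν := ENNReal.toReal_nonneg
  have hγ : 0 ≤ γ := ENNReal.toReal_nonneg
  set Z := ν + γ
  have hZ : 0 ≤ Z := by positivity
  set h : ℝ → (𝔼 n) × (𝔼 n) → ℝ := fun τ => kernelDiff s K (V τ)
  have hh : MemLp (Function.uncurry h) 2 ((volume.restrict (Ioo 0 T)).prod volume) :=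
    hK.memLp_uncurry_kernelDiff hV'
  set a : ℝ → ℝ := fun r => (eLpNorm (timeIntegral h r) 2 volume).toReal
  have hqm : MemLp (Function.uncurry fun τ x => V τ x - g τ x) 2
      ((volume.restrict (Ioo 0 T)).prod volume) := hV.sub hg
  have hqm' : MemLp (Function.uncurry fun τ => fracDiff s (fun x => V τ x - g τ x)) 2
      ((volume.restrict (Ioo 0 T)).prod volume) := by
    simp_rw [fracDiff_sub]
    exact hV'.sub hg'
  have hDU : ∀ r ∈ Ioo 0 T, eLpNorm (fracDiff s (timeIntegral V r)) 2 volume ≤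
      ENNReal.ofReal (l * a r) := fun r hr => by
    refine (hK.eLpNorm_fracDiff_le hlam _).trans ?_
    rw [eLpNorm_congr_ae (kernelDiff_timeIntegral hr.2.le K hV), ENNReal.ofReal_mul hl,
      ENNReal.ofReal_toReal (memLp_timeIntegral hr.2.le hh).2.ne]
  have hQ : ∀ r ∈ Ioo 0 T, MemHsTilde Ω s (timeIntegral (fun τ x => V τ x - g τ x) r) :=
    fun r hr => MemHsTilde.timeIntegral hn hs hb hm hr.2.le hqm hqm' hq
  have hQn : ∀ r ∈ Ioo 0 T, hsNorm s (timeIntegral (fun τ x => V τ x - g τ x) r) ≤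
      ENNReal.ofReal ((P + 1) * (l * a r + γ)) := fun r hr => by
    have h1 : eLpNorm (fracDiff s (timeIntegral (fun τ x => V τ x - g τ x) r)) 2 volume ≤
        ENNReal.ofReal (l * a r + γ) := by
      rw [eLpNorm_congr_ae (fracDiff_ae_congr (timeIntegral_sub hr.2.le hV hg)), fracDiff_sub,
        ENNReal.ofReal_add (mul_nonneg hl ENNReal.toReal_nonneg) hγ, ENNReal.ofReal_toReal hΓ]
      have m1 := aestronglyMeasurable_fracDiff (s := s) (memLp_timeIntegral hr.2.le hV).1
      have m2 := aestronglyMeasurable_fracDiff (s := s) (memLp_timeIntegral hr.2.le hg).1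
      exact (eLpNorm_sub_le m1 m2 (by norm_num)).trans
        (add_le_add (hDU r hr) (eLpNorm_fracDiff_timeIntegral_le_l1HsNorm hr.2.le hg hg'))
    refine (hsNorm_le _).trans ((add_le_add (hP _ (hQ r hr).1.1.1
      ((hQ r hr).ae_eq_zero hm)) le_rfl).trans ?_)
    rw [ENNReal.ofReal_mul (by positivity), ENNReal.ofReal_add hP0.le zero_le_one, add_mul,
      ENNReal.ofReal_one, one_mul]
    gcongr
  have ha : ∀ r ∈ Ioo 0 T, a r ≤ (c + 1) * Z := by
    refine le_mul_of_forall_sq_le (B := √(ENNReal.ofReal T *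
      eLpNorm (Function.uncurry h) 2 ((volume.restrict (Ioo 0 T)).prod volume) ^ 2).toReal)
      hc hZ (fun _ _ => ENNReal.toReal_nonneg) (fun r hr => ?_) fun A hA hAr r hr => ?_
    · refine Real.le_sqrt_of_sq_le ?_
      rw [← ENNReal.toReal_pow]
      exact ENNReal.toReal_mono (ENNReal.mul_ne_top ENNReal.ofReal_ne_top
        (ENNReal.pow_ne_top hh.2.ne)) (eLpNorm_timeIntegral_sq_le hr.2.le hh)
    · have h1 := energy_inequality hK hV hV' hg hg' hq hmon hw₀ hid hr
      have h2 := abs_integral_timeIntegral_mul_kernelDiff_le (K := K) hK hA hr.2.le hh hg' hAr hΓ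
      have h3 := abs_integral_le_hNegNorm hn hs hb hm hN (hQ r hr)
      have h4 : (hsNorm s (timeIntegral (fun τ x => V τ x - g τ x) r)).toReal ≤
          (P + 1) * (l * A + γ) := by
        refine (ENNReal.toReal_le_of_le_ofReal ?_ (hQn r hr)).trans ?_
        · have : 0 ≤ a r := ENNReal.toReal_nonneg
          positivity
        · have := hAr r hr
          gcongr
      have h5 := mul_le_mul_of_nonneg_left h4 hν
      have h6 := (le_abs_self _).trans h2
      have h7 := (le_abs_self _).trans h3
      have h8 : a r ^ 2 ≤ 2 * (A * √Lam * γ + ν * ((P + 1) * (l * A + γ))) := by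
        change 2⁻¹ * a r ^ 2 ≤ _ at h1
        linarith
      refine h8.trans ?_
      -- The slack, expanded with Z = ν + γ, is visibly a sum of nonnegative terms.
      have e : c * (A * Z + Z ^ 2) - 2 * (A * √Lam * γ + ν * ((P + 1) * (l * A + γ))) =
          2 * (A * √Lam * ν + √Lam * Z ^ 2 + (P + 1) * l * (A * γ + Z ^ 2) +
            (P + 1) * (A * Z + ν ^ 2 + ν * γ + γ ^ 2)) := by
        simp only [c, Z]
        ring
      have : 0 ≤ 2 * (A * √Lam * ν + √Lam * Z ^ 2 + (P + 1) * l * (A * γ + Z ^ 2) +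
            (P + 1) * (A * Z + ν ^ 2 + ν * γ + γ ^ 2)) := by positivity
      linarith
  constructor
  · refine essSup_le_of_ae_le _ ?_
    filter_upwards [hid, ae_memLp_of_uncurry hw, ae_restrict_mem measurableSet_Ioo] with t h1 h2 ht
    refine hNegNorm_le h2 fun f hf hf1 => ?_
    have h3 := h1 f hf
    have hf1' : (hsNorm s f).toReal ≤ 1 := ENNReal.toReal_le_of_le_ofReal zero_le_one (by simpa)
    have h4 := (abs_integral_le_hNegNorm hn hs hb hm hN hf).trans
      (mul_le_mul_of_nonneg_left hf1' hν)
    have hκ := hK.memLp_kernelDiff (memHs_iff.1 hf.1).2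
    have h5 := abs_integral_mul_le (memLp_timeIntegral ht.2.le hh) hκ
    have h6 : (eLpNorm (kernelDiff s K f) 2 volume).toReal ≤ √Lam := by
      refine ENNReal.toReal_le_of_le_ofReal (Real.sqrt_nonneg _)
        ((hK.eLpNorm_kernelDiff_le _).trans ?_)
      exact mul_le_of_le_one_right' ((eLpNorm_fracDiff_le_hsNorm f).trans hf1)
    have h7 : a t * (eLpNorm (kernelDiff s K f) 2 volume).toReal ≤ (c + 1) * Z * √Lam :=
      mul_le_mul (ha t ht) h6 ENNReal.toReal_nonneg (by positivity)
    have h8 : ∫ x in Ω, w t x * f x = (∫ x in Ω, w₀ x * f x) -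
        ∫ p, timeIntegral h t p * kernelDiff s K f p := by linarith
    rw [h8]
    refine (abs_sub _ _).trans ((add_le_add h4 (h5.trans h7)).trans ?_)
    have h9 : 0 ≤ ((P + 1) * (l * (c + 1) + 1) + 1 + l * (c + 1)) * Z := by positivity
    have h10 : ν ≤ Z := le_add_of_nonneg_right hγ
    simp only [C]
    linarith
  · refine essSup_le_of_ae_le _ ?_
    filter_upwards [ae_restrict_mem measurableSet_Ioo] with r hr
    have m1 := memLp_timeIntegral hr.2.le hqm
    have m2 := memLp_timeIntegral hr.2.le hg
    have h1 : eLpNorm (timeIntegral V r) 2 volume ≤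
        ENNReal.ofReal ((P + 1) * (l * a r + γ)) + ENNReal.ofReal γ := by
      -- The primitive of V need not vanish outside Ω, so the Poincaré inequality is applied to the
      -- primitive of V - g, and that of g is added back.
      have e : timeIntegral V r =ᵐ[volume] timeIntegral (fun τ x => V τ x - g τ x) r +
          timeIntegral g r := by
        filter_upwards [timeIntegral_sub hr.2.le hV hg] with x hx
        rw [Pi.add_apply, hx]
        ring
      rw [eLpNorm_congr_ae e, ENNReal.ofReal_toReal hΓ]
      exact (eLpNorm_add_le m1.1 m2.1 (by norm_num)).trans (add_le_add
        ((eLpNorm_le_hsNorm _).trans (hQn r hr)) (eLpNorm_timeIntegral_le_l1HsNorm hr.2.le hg))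
    refine (hsNorm_le _).trans ((add_le_add h1 (hDU r hr)).trans ?_)
    have ha0 : 0 ≤ a r := ENNReal.toReal_nonneg
    rw [← ENNReal.ofReal_add (by positivity) hγ, ← ENNReal.ofReal_add (by positivity)
      (by positivity)]
    refine ENNReal.ofReal_le_ofReal ?_
    have h2 : (P + 1) * (l * a r + γ) + γ + l * a r ≤
        (P + 1) * (l * ((c + 1) * Z) + Z) + Z + l * ((c + 1) * Z) := by
      have := ha r hr
      have h10 : γ ≤ Z := le_add_of_nonneg_left hν
      gcongr
    have h9 : 0 ≤ (1 + √Lam * (c + 1)) * Z := by positivity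
    simp only [C]
    linarith

end Estimates

/-! ### Comparison of two solutions and uniqueness. -/

section Solutions

variable {n : ℕ} {s T m lam Lam : ℝ} {Ω : Set (EuclideanSpace ℝ (Fin n))}

local notation "𝔼" k:max => EuclideanSpace ℝ (Fin k)

theorem IsExteriorDatum.eq_zero {φ : ℝ → 𝔼 n → ℝ} (hφ : IsExteriorDatum Ω T s m φ) {t : ℝ}
    (ht : t ∈ Icc 0 T) {x : 𝔼 n} (hx : x ∈ closure Ω) : φ t x = 0 := by
  obtain ⟨S, -, hS, h0⟩ := hφ.compact_support
  exact h0 t ht x fun h => (hS h).2 hx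

variable {K : EuclideanSpace ℝ (Fin n) → EuclideanSpace ℝ (Fin n) → ℝ}
  {u₀ u₀₁ u₀₂ : EuclideanSpace ℝ (Fin n) → ℝ}
  {φ φ₁ φ₂ u u₁ u₂ : ℝ → EuclideanSpace ℝ (Fin n) → ℝ}

theorem IsWeakSolution.ae_eq_exterior (hm : 1 < m) (hΩ : MeasurableSet Ω)
    (hu : IsWeakSolution Ω T s m K u₀ φ u) :
    ∀ᵐ t ∂volume.restrict (Ioo 0 T), ∀ᵐ x ∂volume.restrict Ωᶜ, u t x = φ t x := by
  filter_upwards [hu.exterior.2] with t ht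
  filter_upwards [ht.ae_eq_zero hΩ] with x hx
  rw [← porousPhi_zero (m := m)] at hx
  exact sub_eq_zero.1 ((porousPhi_strictMono hm).injective hx)

/-- The definition of a solution controls Φ^m(u - φ), while the energy argument needs Φ^m(u) -
Φ^m(φ). The two agree almost everywhere: φ = 0 in Ω, and u = φ outside Ω. -/
theorem IsWeakSolution.ae_memHsTilde (hm : 1 < m) (hΩ : MeasurableSet Ω)
    (hφ : IsExteriorDatum Ω T s m φ) (hu : IsWeakSolution Ω T s m K u₀ φ u) :
    ∀ᵐ t ∂volume.restrict (Ioo 0 T),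
      MemHsTilde Ω s fun x => porousPhi m (u t x) - porousPhi m (φ t x) := by
  filter_upwards [hu.exterior.2, hu.ae_eq_exterior hm hΩ, ae_restrict_mem measurableSet_Ioo]
    with t h1 h2 ht
  refine h1.ae_congr ?_
  filter_upwards [ae_imp_of_ae_restrict h2] with x hx
  by_cases hxΩ : x ∈ Ω
  · rw [hφ.eq_zero (Ioo_subset_Icc_self ht) (subset_closure hxΩ), porousPhi_zero, sub_zero,
      sub_zero]
  · rw [hx hxΩ, sub_self, sub_self, porousPhi_zero]

theorem ae_memHsTilde_sub (hn : 1 ≤ n) (hs : 0 < s) (hb : Bornology.IsBounded Ω)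
    (hm : 1 < m) (hΩ : MeasurableSet Ω)
    (hφ₁ : IsExteriorDatum Ω T s m φ₁) (hφ₂ : IsExteriorDatum Ω T s m φ₂)
    (hu₁ : IsWeakSolution Ω T s m K u₀₁ φ₁ u₁) (hu₂ : IsWeakSolution Ω T s m K u₀₂ φ₂ u₂) :
    ∀ᵐ t ∂volume.restrict (Ioo 0 T), MemHsTilde Ω s fun x =>
      (porousPhi m (u₁ t x) - porousPhi m (u₂ t x)) -
        (porousPhi m (φ₁ t x) - porousPhi m (φ₂ t x)) := by
  filter_upwards [hu₁.ae_memHsTilde hm hΩ hφ₁, hu₂.ae_memHsTilde hm hΩ hφ₂] with t h1 h2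
  refine (h1.sub hn hs hb hΩ h2).ae_congr (.of_forall fun x => ?_)
  simp only
  ring

theorem mul_porousPhi_sub_nonneg (hm : 1 < m) (a b : ℝ) :
    0 ≤ (a - b) * (porousPhi m a - porousPhi m b) := by
  rcases le_total a b with h | h
  · exact mul_nonneg_of_nonpos_of_nonpos (sub_nonpos.2 h)
      (sub_nonpos.2 ((porousPhi_strictMono hm).monotone h))
  · exact mul_nonneg (sub_nonneg.2 h) (sub_nonneg.2 ((porousPhi_strictMono hm).monotone h))

theorem mul_porousPhi_sub_sub_eq (hφ₁ : IsExteriorDatum Ω T s m φ₁)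
    (hφ₂ : IsExteriorDatum Ω T s m φ₂) {t : ℝ} (ht : t ∈ Ioo 0 T) {x : 𝔼 n} (hx : x ∈ Ω) :
    (u₁ t x - u₂ t x) * ((porousPhi m (u₁ t x) - porousPhi m (u₂ t x)) -
      (porousPhi m (φ₁ t x) - porousPhi m (φ₂ t x))) =
    (u₁ t x - u₂ t x) * (porousPhi m (u₁ t x) - porousPhi m (u₂ t x)) := by
  rw [hφ₁.eq_zero (Ioo_subset_Icc_self ht) (subset_closure hx),
    hφ₂.eq_zero (Ioo_subset_Icc_self ht) (subset_closure hx), sub_self, sub_zero]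

theorem ae_forall_integral_sub_eq (hn : 1 ≤ n) (hs : 0 < s) (hT : 0 < T) (hm : 1 < m)
    (hb : Bornology.IsBounded Ω) (hΩ : MeasurableSet Ω) (hK : IsEllipticKernel lam Lam K)
    (hlam : 0 < lam) (hu₁ : IsWeakSolution Ω T s m K u₀₁ φ₁ u₁)
    (hu₂ : IsWeakSolution Ω T s m K u₀₂ φ₂ u₂) (h₁ : MemLp u₀₁ 2 (volume.restrict Ω))
    (h₂ : MemLp u₀₂ 2 (volume.restrict Ω)) :
    ∀ᵐ t ∂volume.restrict (Ioo 0 T), ∀ f, MemHsTilde Ω s f →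
      (∫ x in Ω, (u₁ t x - u₂ t x) * f x) +
      ∫ p, timeIntegral (fun τ => kernelDiff s K fun x =>
        porousPhi m (u₁ τ x) - porousPhi m (u₂ τ x)) t p * kernelDiff s K f p =
        ∫ x in Ω, (u₀₁ x - u₀₂ x) * f x := by
  have hh₁ := hK.memLp_uncurry_kernelDiff hu₁.memL2Hs.memLp_fracDiff
  have hh₂ := hK.memLp_uncurry_kernelDiff hu₂.memL2Hs.memLp_fracDiff
  filter_upwards [hu₁.ae_forall_integral_eq hn hs hT hm hb hΩ hK hlam h₁,
    hu₂.ae_forall_integral_eq hn hs hT hm hb hΩ hK hlam h₂,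
    ae_memLp_of_uncurry (memLp_uncurry_of_porousPhi (Ω := Ω) hm hb hu₁.memL2Hs),
    ae_memLp_of_uncurry (memLp_uncurry_of_porousPhi (Ω := Ω) hm hb hu₂.memL2Hs),
    ae_restrict_mem measurableSet_Ioo] with t e1 e2 hut₁ hut₂ ht f hf
  have hfΩ := hf.1.1.restrict Ω
  have hκ := hK.memLp_kernelDiff (memHs_iff.1 hf.1).2
  have hH₁ := memLp_timeIntegral ht.2.le hh₁
  have hH₂ := memLp_timeIntegral ht.2.le hh₂
  have a1 : ∫ x in Ω, (u₁ t x - u₂ t x) * f x =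
      (∫ x in Ω, u₁ t x * f x) - ∫ x in Ω, u₂ t x * f x := by
    rw [← integral_sub (integrable_mul_of_memLp_two hut₁ hfΩ)
      (integrable_mul_of_memLp_two hut₂ hfΩ)]
    simp only [sub_mul]
  have a2 : ∫ x in Ω, (u₀₁ x - u₀₂ x) * f x =
      (∫ x in Ω, u₀₁ x * f x) - ∫ x in Ω, u₀₂ x * f x := by
    rw [← integral_sub (integrable_mul_of_memLp_two h₁ hfΩ) (integrable_mul_of_memLp_two h₂ hfΩ)]
    simp only [sub_mul]
  have a3 : ∫ p, timeIntegral (fun τ => kernelDiff s K fun x =>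
      porousPhi m (u₁ τ x) - porousPhi m (u₂ τ x)) t p * kernelDiff s K f p =
      (∫ p, timeIntegral (fun τ => kernelDiff s K fun x => porousPhi m (u₁ τ x)) t p *
        kernelDiff s K f p) -
      ∫ p, timeIntegral (fun τ => kernelDiff s K fun x => porousPhi m (u₂ τ x)) t p *
        kernelDiff s K f p := by
    rw [← integral_sub (integrable_mul_of_memLp_two hH₁ hκ) (integrable_mul_of_memLp_two hH₂ hκ)]
    refine integral_congr_ae ?_
    filter_upwards [timeIntegral_sub ht.2.le hh₁ hh₂] with p hp
    simp_rw [kernelDiff_sub]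
    rw [hp, sub_mul]
  have := e1 f hf
  have := e2 f hf
  linarith

theorem exists_continuous_dependence_const (hn : 1 ≤ n) (hs : 0 < s) (hT : 0 < T) (hm : 1 < m)
    (hb : Bornology.IsBounded Ω) (hΩ : MeasurableSet Ω) (Lam : ℝ) (hlam : 0 < lam) :
    ∃ C : ℝ, 0 < C ∧ ∀ K : 𝔼 n → 𝔼 n → ℝ, IsEllipticKernel lam Lam K →
      ∀ u₀₁ u₀₂ : 𝔼 n → ℝ, IsInitialDatum Ω s u₀₁ → IsInitialDatum Ω s u₀₂ →
      ∀ φ₁ φ₂ : ℝ → 𝔼 n → ℝ, IsExteriorDatum Ω T s m φ₁ → IsExteriorDatum Ω T s m φ₂ →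
      ∀ u₁ u₂ : ℝ → 𝔼 n → ℝ,
        IsWeakSolution Ω T s m K u₀₁ φ₁ u₁ → IsWeakSolution Ω T s m K u₀₂ φ₂ u₂ →
        lInftyHNegNorm Ω T s (fun t x => u₁ t x - u₂ t x) +
            lInftyHsNorm T s (fun t x => timePrimitive m u₁ t x - timePrimitive m u₂ t x) ≤
          ENNReal.ofReal C *
            (hNegNorm Ω s (fun x => u₀₁ x - u₀₂ x) +
              l1HsNorm T s (fun t x => porousPhi m (φ₁ t x) - porousPhi m (φ₂ t x))) := by
  obtain ⟨C, hC, H⟩ := exists_stability_const hn hs hb hΩ T Lam hlam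
  refine ⟨2 * C, by positivity, ?_⟩
  intro K hK u₀₁ u₀₂ h₀₁ h₀₂ φ₁ φ₂ hφ₁ hφ₂ u₁ u₂ hu₁ hu₂
  set N := hNegNorm Ω s (fun x => u₀₁ x - u₀₂ x)
  set Γ := l1HsNorm T s (fun t x => porousPhi m (φ₁ t x) - porousPhi m (φ₂ t x))
  -- The estimate is trivial when the right side is infinite; otherwise the real-valued stability
  -- bounds apply, and adding the two explains the constant 2C.
  by_cases hfin : N + Γ = ∞
  · rw [hfin, ENNReal.mul_top (by simpa using hC)]
    exact le_top
  rw [ENNReal.add_eq_top, not_or] at hfin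
  have l₁ : MemLp u₀₁ 2 (volume.restrict Ω) := h₀₁.memHsTilde.1.1.restrict Ω
  have l₂ : MemLp u₀₂ 2 (volume.restrict Ω) := h₀₂.memHsTilde.1.1.restrict Ω
  have hV := hu₁.memL2Hs.memLp.sub hu₂.memL2Hs.memLp
  have hV' : MemLp (Function.uncurry fun t => fracDiff s fun x =>
      porousPhi m (u₁ t x) - porousPhi m (u₂ t x)) 2
      ((volume.restrict (Ioo 0 T)).prod volume) := by
    simp_rw [fracDiff_sub]
    exact hu₁.memL2Hs.memLp_fracDiff.sub hu₂.memL2Hs.memLp_fracDiff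
  have hg := hφ₁.memL2Hs.memLp.sub hφ₂.memL2Hs.memLp
  have hg' : MemLp (Function.uncurry fun t => fracDiff s fun x =>
      porousPhi m (φ₁ t x) - porousPhi m (φ₂ t x)) 2
      ((volume.restrict (Ioo 0 T)).prod volume) := by
    simp_rw [fracDiff_sub]
    exact hφ₁.memL2Hs.memLp_fracDiff.sub hφ₂.memL2Hs.memLp_fracDiff
  have hw := (memLp_uncurry_of_porousPhi (Ω := Ω) hm hb hu₁.memL2Hs).sub
    (memLp_uncurry_of_porousPhi (Ω := Ω) hm hb hu₂.memL2Hs)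
  have hmon : ∀ᵐ t ∂volume.restrict (Ioo 0 T), 0 ≤ ∫ x in Ω, (u₁ t x - u₂ t x) *
      ((porousPhi m (u₁ t x) - porousPhi m (u₂ t x)) -
        (porousPhi m (φ₁ t x) - porousPhi m (φ₂ t x))) := by
    filter_upwards [ae_restrict_mem measurableSet_Ioo] with t ht
    refine setIntegral_nonneg hΩ fun x hx => ?_
    rw [mul_porousPhi_sub_sub_eq hφ₁ hφ₂ ht hx]
    exact mul_porousPhi_sub_nonneg hm _ _
  obtain ⟨r1, r2⟩ := H K hK (fun t x => porousPhi m (u₁ t x) - porousPhi m (u₂ t x))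
    (fun t x => porousPhi m (φ₁ t x) - porousPhi m (φ₂ t x)) (fun t x => u₁ t x - u₂ t x)
    (fun x => u₀₁ x - u₀₂ x) hV hV' hg hg' hw
    (ae_memHsTilde_sub hn hs hb hm hΩ hφ₁ hφ₂ hu₁ hu₂) hmon (l₁.sub l₂)
    (ae_forall_integral_sub_eq hn hs hT hm hb hΩ hK hlam hu₁ hu₂ l₁ l₂) hfin.1 hfin.2
  have e : lInftyHsNorm T s (fun t x => timePrimitive m u₁ t x - timePrimitive m u₂ t x) =
      lInftyHsNorm T s
        (timeIntegral fun t x => porousPhi m (u₁ t x) - porousPhi m (u₂ t x)) := by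
    refine essSup_congr_ae ?_
    filter_upwards [ae_restrict_mem measurableSet_Ioo] with t ht
    exact hsNorm_ae_congr (timeIntegral_sub ht.2.le hu₁.memL2Hs.memLp hu₂.memL2Hs.memLp).symm
  rw [e]
  refine (add_le_add r1 r2).trans (le_of_eq ?_)
  rw [ENNReal.ofReal_mul hC.le, ENNReal.ofReal_add ENNReal.toReal_nonneg ENNReal.toReal_nonneg,
    ENNReal.ofReal_toReal hfin.1, ENNReal.ofReal_toReal hfin.2, ENNReal.ofReal_mul zero_le_two,
    ENNReal.ofReal_ofNat]
  ring

/-- For almost every t the difference u₁ - u₂ has dual norm zero, hence integrates to zero against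
Φ^m(u₁) - Φ^m(u₂), which is itself an admissible test function. The integrand is nonnegative and
vanishes only where u₁ = u₂; outside Ω both solutions equal φ. -/
theorem IsWeakSolution.ae_eq (hn : 1 ≤ n) (hs : 0 < s) (hT : 0 < T) (hm : 1 < m)
    (hb : Bornology.IsBounded Ω) (hΩ : MeasurableSet Ω) (hlam : 0 < lam)
    (hK : IsEllipticKernel lam Lam K) (h₀ : IsInitialDatum Ω s u₀)
    (hφ : IsExteriorDatum Ω T s m φ) (hu₁ : IsWeakSolution Ω T s m K u₀ φ u₁)
    (hu₂ : IsWeakSolution Ω T s m K u₀ φ u₂) :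
    ∀ᵐ p ∂((volume.restrict (Ioo (0 : ℝ) T)).prod (volume : Measure (𝔼 n))),
      u₁ p.1 p.2 = u₂ p.1 p.2 := by
  obtain ⟨C, -, H⟩ := exists_continuous_dependence_const hn hs hT hm hb hΩ Lam hlam
  have h1 := H K hK u₀ u₀ h₀ h₀ φ φ hφ hφ u₁ u₂ hu₁ hu₂
  have z1 : hNegNorm Ω s (fun x => u₀ x - u₀ x) = 0 := by
    simp [hNegNorm]
  have z2 : l1HsNorm T s (fun t x => porousPhi m (φ t x) - porousPhi m (φ t x)) = 0 := by
    simp [l1HsNorm, hsNorm, gagliardoSq]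
  rw [z1, z2, add_zero, mul_zero, nonpos_iff_eq_zero, add_eq_zero] at h1
  have hneg : ∀ᵐ t ∂volume.restrict (Ioo 0 T), hNegNorm Ω s (fun x => u₁ t x - u₂ t x) = 0 := by
    filter_upwards [ENNReal.ae_le_essSup fun t => hNegNorm Ω s fun x => u₁ t x - u₂ t x] with t ht
    exact le_antisymm (ht.trans h1.1.le) zero_le
  have hae : ∀ᵐ t ∂volume.restrict (Ioo 0 T), ∀ᵐ x : 𝔼 n, u₁ t x = u₂ t x := by
    filter_upwards [hneg, ae_memHsTilde_sub hn hs hb hm hΩ hφ hφ hu₁ hu₂,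
      hu₁.ae_eq_exterior hm hΩ, hu₂.ae_eq_exterior hm hΩ,
      ae_memLp_of_uncurry (memLp_uncurry_of_porousPhi (Ω := Ω) hm hb hu₁.memL2Hs),
      ae_memLp_of_uncurry (memLp_uncurry_of_porousPhi (Ω := Ω) hm hb hu₂.memL2Hs),
      ae_restrict_mem measurableSet_Ioo] with t h2 hq e1 e2 l1 l2 ht
    have h3 := abs_integral_le_hNegNorm hn hs hb hΩ (by rw [h2]; exact ENNReal.zero_ne_top) hq
    rw [h2, ENNReal.toReal_zero, zero_mul] at h3
    have h4 := abs_nonpos_iff.1 h3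
    have hnn : 0 ≤ᵐ[volume.restrict Ω] fun x => (u₁ t x - u₂ t x) *
        ((porousPhi m (u₁ t x) - porousPhi m (u₂ t x)) -
          (porousPhi m (φ t x) - porousPhi m (φ t x))) := by
      filter_upwards [ae_restrict_mem hΩ] with x hx
      rw [mul_porousPhi_sub_sub_eq hφ hφ ht hx]
      exact mul_porousPhi_sub_nonneg hm _ _
    rw [integral_eq_zero_iff_of_nonneg_ae hnn
      (integrable_mul_of_memLp_two (l1.sub l2) (hq.1.1.restrict Ω))] at h4
    have h5 : ∀ᵐ x ∂volume.restrict Ω, u₁ t x = u₂ t x := by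
      filter_upwards [h4, ae_restrict_mem hΩ] with x h6 hx
      rw [mul_porousPhi_sub_sub_eq hφ hφ ht hx] at h6
      rcases mul_eq_zero.1 h6 with h7 | h7
      · exact sub_eq_zero.1 h7
      · exact (porousPhi_strictMono hm).injective (sub_eq_zero.1 h7)
    filter_upwards [ae_imp_of_ae_restrict h5, ae_imp_of_ae_restrict e1, ae_imp_of_ae_restrict e2]
      with x h6 h7 h8
    by_cases hx : x ∈ Ω
    · exact h6 hx
    · rw [h7 hx, h8 hx]
  -- Passing from equality on almost every time slice to equality almost everywhere in space-time
  -- needs joint measurability of u₁ and u₂; Tonelli then applies to |u₁ - u₂|.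
  have m1 := aestronglyMeasurable_of_porousPhi hm (f := Function.uncurry u₁) hu₁.memL2Hs.1
  have m2 := aestronglyMeasurable_of_porousPhi hm (f := Function.uncurry u₂) hu₂.memL2Hs.1
  have m3 : AEMeasurable (fun p : ℝ × 𝔼 n => ‖u₁ p.1 p.2 - u₂ p.1 p.2‖ₑ)
      ((volume.restrict (Ioo 0 T)).prod volume) := (m1.sub m2).enorm
  have h2 : ∫⁻ p : ℝ × 𝔼 n, ‖u₁ p.1 p.2 - u₂ p.1 p.2‖ₑ
      ∂((volume.restrict (Ioo 0 T)).prod volume) = 0 := by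
    rw [lintegral_prod _ m3, lintegral_congr_ae (g := fun _ => 0)]
    · simp
    · filter_upwards [hae] with t ht
      rw [lintegral_congr_ae (g := fun _ => 0)]
      · simp
      · filter_upwards [ht] with x hx
        simp [hx]
  filter_upwards [(lintegral_eq_zero_iff' m3).1 h2] with p hp
  exact sub_eq_zero.1 (enorm_eq_zero.1 hp)

end Solutions

theorem mainTheorem7 (n : ℕ) (hn : 1 ≤ n) (Ω : Set (EuclideanSpace ℝ (Fin n)))
    (hΩ : IsBoundedLipschitzDomain Ω) (T : ℝ) (hT : 0 < T) (s : ℝ) (hs₀ : 0 < s) (hs₁ : s < 1)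
    (m : ℝ) (hm : 1 < m) (lam Lam : ℝ) (hlam : 0 < lam) (hLam : lam ≤ Lam) :
    (∃ C : ℝ, 0 < C ∧
      ∀ K : EuclideanSpace ℝ (Fin n) → EuclideanSpace ℝ (Fin n) → ℝ,
        IsEllipticKernel lam Lam K →
      ∀ u₀₁ u₀₂ : EuclideanSpace ℝ (Fin n) → ℝ,
        IsInitialDatum Ω s u₀₁ → IsInitialDatum Ω s u₀₂ →
      ∀ φ₁ φ₂ : ℝ → EuclideanSpace ℝ (Fin n) → ℝ,
        IsExteriorDatum Ω T s m φ₁ → IsExteriorDatum Ω T s m φ₂ →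
      ∀ u₁ u₂ : ℝ → EuclideanSpace ℝ (Fin n) → ℝ,
        IsWeakSolution Ω T s m K u₀₁ φ₁ u₁ → IsWeakSolution Ω T s m K u₀₂ φ₂ u₂ →
        lInftyHNegNorm Ω T s (fun t x => u₁ t x - u₂ t x) +
            lInftyHsNorm T s (fun t x => timePrimitive m u₁ t x - timePrimitive m u₂ t x) ≤
          ENNReal.ofReal C *
            (hNegNorm Ω s (fun x => u₀₁ x - u₀₂ x) +
              l1HsNorm T s (fun t x => porousPhi m (φ₁ t x) - porousPhi m (φ₂ t x)))) ∧
    (∀ K : EuclideanSpace ℝ (Fin n) → EuclideanSpace ℝ (Fin n) → ℝ,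
        IsEllipticKernel lam Lam K →
      ∀ u₀ : EuclideanSpace ℝ (Fin n) → ℝ, IsInitialDatum Ω s u₀ →
      ∀ φ : ℝ → EuclideanSpace ℝ (Fin n) → ℝ, IsExteriorDatum Ω T s m φ →
      ∀ u₁ u₂ : ℝ → EuclideanSpace ℝ (Fin n) → ℝ,
        IsWeakSolution Ω T s m K u₀ φ u₁ → IsWeakSolution Ω T s m K u₀ φ u₂ →
        ∀ᵐ p ∂((volume.restrict (Ioo (0 : ℝ) T)).prod
            (volume : Measure (EuclideanSpace ℝ (Fin n)))), u₁ p.1 p.2 = u₂ p.1 p.2) := by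
  have hm' := hΩ.isOpen.measurableSet
  exact ⟨exists_continuous_dependence_const hn hs₀ hT hm hΩ.isBounded hm' Lam hlam,
    fun K hK u₀ h₀ φ hφ u₁ u₂ hu₁ hu₂ =>
      hu₁.ae_eq hn hs₀ hT hm hΩ.isBounded hm' hlam hK h₀ hφ hu₂⟩
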